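/- Setting. Let $U,A,Z,W$ be random variables with values in standard Borel spaces $\mathcal U,\mathcal A,\mathcal Z,\mathcal W$ and let $Y$ be a real random variable, all on one (standard Borel) probability space: $A$ is the treatment, $Y$ the outcome, $U$ an unobserved confounder, $Z$ and $W$ the treatment- and the outcome-inducing proxy. Assume $Y\perp Z\mid (A,U)$ and $W\perp (A,Z)\mid U$, and that $Z$ is complete, at every treatment level, for the confounder and for the outcome-inducing proxy: for $X=U$ and for $X=W$, if $l:\mathcal A\times\mathcal X\to\mathbb R$ is square integrable (for $P_A\otimes P_X$ and for $P_{A,X}$) and $\mathbb E[l(a,X)\mid A=a,Z=z]=0$ for almost all $(a,z)$, then $l=0$ $P_A\otimes P_X$-almost everywhere. The structural function is $f_{\mathrm{struct}}(a)=\mathbb E_U[\mathbb E[Y\mid A=a,U]]$. Let $h^*$ be a bridge function: $h^*(A,W)\in L^2$ and $\mathbb E[Y\mid A,Z]=\mathbb E[h^*(A,W)\mid A,Z]$ almost surely. Model. Let $\phi_{\theta_{A(1)}},\phi_{\theta_Z},\psi_{\theta_{A(2)}},\psi_{\theta_W}$ be measurable parametrized feature maps with values in finite-dimensional Euclidean spaces,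 let $\Theta_1$ be the set of admissible stage-1 parameters $(V,\theta_{A(1)},\theta_Z)$ and $\Theta_2$ the set of admissible stage-2 parameters $(u,\theta_{A(2)},\theta_W)$. The bridge function is modelled by $h(a,w)=u^\top(\psi_{\theta_{A(2)}}(a)\otimes\psi_{\theta_W}(w))$, and $\mathbb E[\psi_{\theta_W}(W)\mid A=a,Z=z]$ by $V(\phi_{\theta_{A(1)}}(a)\otimes\phi_{\theta_Z}(z))$. Both classes are pointwise separable (a countable subset of the admissible parameters approximates pointwise, along sequences, the functions of all of them; this holds for networks that are continuous in Euclidean parameters). Boundedness. For a constant $M$: $|Y|\le M$ almost surely, and for all admissible parameters, all $a,z,w$ and all vectors $v$ with $\|v\|\le1$: $\|V(\phi_{\theta_{A(1)}}(a)\otimes\phi_{\theta_Z}(z))\|\le M$, $\|\psi_{\theta_W}(w)\|\le M$ and $|u^\top(\psi_{\theta_{A(2)}}(a)\otimes v)|\le M$. Support. $P_A\otimes P_W$ is absolutely continuous with respect to $P_{A,W}$ with density at most $\eta<\infty$. Data and estimator. Let $S_1=\{(w_i,a_i,z_i)\}_{i\le m}$ and $S_2=\{(\tilde y_i,\tilde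 a_i,\tilde z_i)\}_{i\le n}$ be i.i.d. samples of $(W,A,Z)$ and $(Y,A,Z)$ (not necessarily independent of each other), and let $S_W=\{w_i^{\mathrm{extra}}\}_{i\le n_W}$ be an i.i.d. sample of $W$ that is independent of $(S_1,S_2)$, with $m,n,n_W\ge1$. Let $\lambda_1,\lambda_2\ge0$ (possibly $0$, possibly depending on the sample sizes) satisfy $\lambda_1\|V\|^2\le\Lambda/\sqrt m$ and $\lambda_2\|u\|^2\le\Lambda/\sqrt n$ for all admissible parameters. For every admissible $\theta_W$ let $(\hat V,\hat\theta_{A(1)},\hat\theta_Z)=(\hat V,\hat\theta_{A(1)},\hat\theta_Z)(\theta_W)$ minimize over $\Theta_1$ $$\hat{\mathcal L}_1=\frac1m\sum_{i=1}^m\big\|\psi_{\theta_W}(w_i)-V(\phi_{\theta_{A(1)}}(a_i)\otimes\phi_{\theta_Z}(z_i))\big\|^2+\lambda_1\|V\|^2 ,$$ let $(\hat u,\hat\theta_{A(2)},\hat\theta_W)$, a function of $(S_1,S_2)$ that makes the estimated bridge function jointly measurable in the data and in $(a,w)$, minimize over $\Theta_2$ $$\hat{\mathcal L}_2=\frac1n\sum_{i=1}^n\Big(\tilde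 y_i-u^\top\big(\psi_{\theta_{A(2)}}(\tilde a_i)\otimes\hat V(\phi_{\hat\theta_{A(1)}}(\tilde a_i)\otimes\phi_{\hat\theta_Z}(\tilde z_i))\big)\Big)^2+\lambda_2\|u\|^2 ,$$ where $(\hat V,\hat\theta_{A(1)},\hat\theta_Z)$ is the stage-1 minimizer for the parameter $\theta_W$, and put $\hat f_{\mathrm{struct}}(a)=\hat u^\top\big(\psi_{\hat\theta_{A(2)}}(a)\otimes\frac1{n_W}\sum_{i=1}^{n_W}\psi_{\hat\theta_W}(w_i^{\mathrm{extra}})\big)$. Quantities in the bound. Let $$\mathcal H_1=\{(w,a,z)\mapsto\|\psi_{\theta_W}(w)-V(\phi_{\theta_{A(1)}}(a)\otimes\phi_{\theta_Z}(z))\|^2\},$$ $$\mathcal H_2=\{(y,a,z)\mapsto(y-u^\top(\psi_{\theta_{A(2)}}(a)\otimes V(\phi_{\theta_{A(1)}}(a)\otimes\phi_{\theta_Z}(z))))^2\},$$ over all admissible parameters, let $\hat{\mathfrak R}_S(\mathcal H)=\mathbb E_\sigma\sup_{g\in\mathcal H}\frac1k\sum_{i=1}^k\sigma_ig(s_i)$,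 with independent uniform signs $\sigma_i$, be the empirical Rademacher complexity on a sample $S=(s_1,\dots,s_k)$, let $$\kappa_1=\sup_{\theta_W}\inf_{V,\theta_{A(1)},\theta_Z}\mathbb E\big\|\mathbb E[\psi_{\theta_W}(W)\mid A,Z]-V(\phi_{\theta_{A(1)}}(A)\otimes\phi_{\theta_Z}(Z))\big\|^2,$$ $$\kappa_2=\inf_{u,\theta_{A(2)},\theta_W}\big\|\mathbb E[Y\mid A,Z]-\mathbb E[h(A,W)\mid A,Z]\big\|_{L^2},$$ and let $$\tau=\sup_{h}\frac{\|h-h^*\|_{L^2(P_{A,W})}}{\|\mathbb E[(h-h^*)(A,W)\mid A,Z]\|_{L^2}}\in[0,\infty],$$ over the bridge functions $h$ of the model (with $0/0=0$ and $c/0=\infty$ for $c>0$), be the measure of ill-posedness of the bridge equation. Claim. For every $\delta>0$ there is a constant $C$, which depends only on $M$, $\eta$, $\Lambda$ and $\delta$ (the underlying spaces being fixed), such that in every such situation and for all $m,n,n_W\ge 1$, with probability at least $1-\delta$, $$\|f_{\mathrm{struct}}-\hat f_{\mathrm{struct}}\|_{L^2(P_A)}\le C\left(\tau\left(\sqrt{\kappa_1+\hat{\mathfrak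 R}_{S_1}(\mathcal H_1)+\frac1{\sqrt m}}+\kappa_2+\sqrt{\hat{\mathfrak R}_{S_2}(\mathcal H_2)+\frac1{\sqrt n}}\right)+\frac1{\sqrt{n_W}}\right).$$ In particular, if $\tau<\infty$, then $$\|f_{\mathrm{struct}}-\hat f_{\mathrm{struct}}\|_{L^2(P_A)}\le O_p\left(\sqrt{\kappa_1+\hat{\mathfrak R}_{S_1}(\mathcal H_1)+\frac1{\sqrt m}}+\kappa_2+\sqrt{\hat{\mathfrak R}_{S_2}(\mathcal H_2)+\frac1{\sqrt n}}+\frac1{\sqrt{n_W}}\right).$$ -/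

import Mathlib

open MeasureTheory ProbabilityTheory Filter Topology
open scoped ENNReal

namespace DFPV

/-- The population: a treatment `A`, proxies `Z` (treatment-inducing) and `W` (outcome-inducing),
a real outcome `Y` and an unobserved confounder `U` on a probability space. -/
structure Population (Ω 𝒰 𝒜 𝒵 𝒲 : Type*) [MeasurableSpace Ω] [MeasurableSpace 𝒰]
    [MeasurableSpace 𝒜] [MeasurableSpace 𝒵] [MeasurableSpace 𝒲] where
  μ : Measure Ω
  isProb : IsProbabilityMeasure μ
  U : Ω → 𝒰
  A : Ω → 𝒜
  Z : Ω → 𝒵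
  W : Ω → 𝒲
  Y : Ω → ℝ
  measU : Measurable U
  measA : Measurable A
  measZ : Measurable Z
  measW : Measurable W
  measY : Measurable Y

namespace Population

variable {Ω 𝒰 𝒜 𝒵 𝒲 : Type*} [MeasurableSpace Ω] [MeasurableSpace 𝒰]
    [MeasurableSpace 𝒜] [MeasurableSpace 𝒵] [MeasurableSpace 𝒲]

instance (P : Population Ω 𝒰 𝒜 𝒵 𝒲) : IsProbabilityMeasure P.μ := P.isProb

/-- The law of `A`. -/
noncomputable def lawA (P : Population Ω 𝒰 𝒜 𝒵 𝒲) : Measure 𝒜 := P.μ.map P.A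

/-- The law of `U`. -/
noncomputable def lawU (P : Population Ω 𝒰 𝒜 𝒵 𝒲) : Measure 𝒰 := P.μ.map P.U

/-- The law of `W`. -/
noncomputable def lawW (P : Population Ω 𝒰 𝒜 𝒵 𝒲) : Measure 𝒲 := P.μ.map P.W

/-- The joint law of `(A, W)`. -/
noncomputable def lawAW (P : Population Ω 𝒰 𝒜 𝒵 𝒲) : Measure (𝒜 × 𝒲) :=
  P.μ.map (fun ω => (P.A ω, P.W ω))

/-- The law of one stage 1 observation `(W, A, Z)`. -/
noncomputable def lawWAZ (P : Population Ω 𝒰 𝒜 𝒵 𝒲) : Measure (𝒲 × 𝒜 × 𝒵) :=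
  P.μ.map (fun ω => (P.W ω, P.A ω, P.Z ω))

/-- The law of one stage 2 observation `(Y, A, Z)`. -/
noncomputable def lawYAZ (P : Population Ω 𝒰 𝒜 𝒵 𝒲) : Measure (ℝ × 𝒜 × 𝒵) :=
  P.μ.map (fun ω => (P.Y ω, P.A ω, P.Z ω))

/-- The conditional expectation `E[f | A, Z]`, as a random variable. -/
noncomputable def condAZ (P : Population Ω 𝒰 𝒜 𝒵 𝒲) (f : Ω → ℝ) : Ω → ℝ :=
  P.μ[f | MeasurableSpace.comap (fun ω => (P.A ω, P.Z ω)) inferInstance]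

/-- The structural function `f_struct(a) = E_U[ E[Y | A = a, U] ]`. -/
noncomputable def fStruct (P : Population Ω 𝒰 𝒜 𝒵 𝒲) (a : 𝒜) : ℝ :=
  ∫ u, (∫ y, y ∂(condDistrib P.Y (fun ω => (P.A ω, P.U ω)) P.μ (a, u))) ∂P.lawU

/-- The structural assumption: `Y ⫫ Z | (A, U)` and `W ⫫ (A, Z) | U`. -/
def Structural [StandardBorelSpace Ω] (P : Population Ω 𝒰 𝒜 𝒵 𝒲) : Prop :=
  CondIndepFun (MeasurableSpace.comap (fun ω => (P.A ω, P.U ω)) inferInstance)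
      (P.measA.prodMk P.measU).comap_le P.Y P.Z P.μ ∧
    CondIndepFun (MeasurableSpace.comap P.U inferInstance)
      P.measU.comap_le P.W (fun ω => (P.A ω, P.Z ω)) P.μ

/-- Completeness of `Z` for a variable `X`, at every treatment level: if
`E[l(a, X) | A = a, Z = z] = 0` for (almost) all `(a, z)`, then, for almost every `a`,
`l(a, ·) = 0` almost everywhere for the law of `X`. (For `l` depending on `X` only, the converse
implication is automatic.) -/
def CompleteFor {χ : Type*} [MeasurableSpace χ] (P : Population Ω 𝒰 𝒜 𝒵 𝒲) (X : Ω → χ) : Prop :=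
  ∀ l : 𝒜 × χ → ℝ, Measurable l →
    MemLp l 2 (P.lawA.prod (P.μ.map X)) →
    MemLp (fun ω => l (P.A ω, X ω)) 2 P.μ →
    P.condAZ (fun ω => l (P.A ω, X ω)) =ᵐ[P.μ] 0 →
    l =ᵐ[P.lawA.prod (P.μ.map X)] 0

/-- `h` is a (square integrable) bridge function: `E[Y | A, Z] = E[h(A, W) | A, Z]`. -/
structure IsBridge (P : Population Ω 𝒰 𝒜 𝒵 𝒲) (h : 𝒜 → 𝒲 → ℝ) : Prop where
  measurable : Measurable (fun x : 𝒜 × 𝒲 => h x.1 x.2)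
  memLp : MemLp (fun ω => h (P.A ω) (P.W ω)) 2 P.μ
  bridge : P.condAZ P.Y =ᵐ[P.μ] P.condAZ (fun ω => h (P.A ω) (P.W ω))

/-- The support condition: `P_A ⊗ P_W` is absolutely continuous with respect to the joint law of
`(A, W)`, with Radon-Nikodym derivative at most `η`. -/
def GoodSupport (P : Population Ω 𝒰 𝒜 𝒵 𝒲) (η : ℝ) : Prop :=
  P.lawA.prod P.lawW ≤ ENNReal.ofReal η • P.lawAW

end Population

/-- The Kronecker product of two vectors. -/
def kron {p q : ℕ} (x : Fin p → ℝ) (y : Fin q → ℝ) : Fin p × Fin q → ℝ :=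
  fun ij => x ij.1 * y ij.2

/-- The squared Euclidean norm (for matrices, given by their entries: the Frobenius norm). -/
def sqNorm {ι : Type*} [Fintype ι] (x : ι → ℝ) : ℝ := ∑ i, x i ^ 2

/-- Stage 1 parameters `(V, θ_{A(1)}, θ_Z)`. -/
structure Param1 (ΘA1 ΘZ : Type*) (pA pZ d : ℕ) where
  V : Matrix (Fin d) (Fin pA × Fin pZ) ℝ
  θA : ΘA1
  θZ : ΘZ

/-- Stage 2 parameters `(u, θ_{A(2)}, θ_W)`. -/
structure Param2 (ΘA2 ΘW : Type*) (qA d : ℕ) where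
  u : Fin qA × Fin d → ℝ
  θA : ΘA2
  θW : ΘW

/-- The four parametrized feature maps and the sets of admissible parameters of the two stages. -/
structure Model (𝒜 𝒵 𝒲 ΘA1 ΘZ ΘA2 ΘW : Type*) [MeasurableSpace 𝒜] [MeasurableSpace 𝒵]
    [MeasurableSpace 𝒲] (pA pZ qA d : ℕ) where
  φA : ΘA1 → 𝒜 → (Fin pA → ℝ)
  φZ : ΘZ → 𝒵 → (Fin pZ → ℝ)
  ψA : ΘA2 → 𝒜 → (Fin qA → ℝ)
  ψW : ΘW → 𝒲 → (Fin d → ℝ)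
  meas_φA : ∀ θ, Measurable (φA θ)
  meas_φZ : ∀ θ, Measurable (φZ θ)
  meas_ψA : ∀ θ, Measurable (ψA θ)
  meas_ψW : ∀ θ, Measurable (ψW θ)
  adm1 : Set (Param1 ΘA1 ΘZ pA pZ d)
  adm2 : Set (Param2 ΘA2 ΘW qA d)

/-- The empirical Rademacher complexity of the class `H` on the sample `s`:
the average over all sign vectors `σ` of `sup_{h ∈ H} (1/k) ∑ i, σ i * h (s i)`. -/
noncomputable def empRademacher {S : Type*} {k : ℕ} (H : Set (S → ℝ)) (s : Fin k → S) : ℝ :=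
  ((2 : ℝ) ^ k)⁻¹ * ∑ σ : Fin k → Bool,
    ⨆ h : H, (k : ℝ)⁻¹ * ∑ i, (if σ i then (1 : ℝ) else -1) * h.1 (s i)

namespace Model

variable {𝒜 𝒵 𝒲 ΘA1 ΘZ ΘA2 ΘW : Type*} [MeasurableSpace 𝒜] [MeasurableSpace 𝒵]
    [MeasurableSpace 𝒲] {pA pZ qA d : ℕ}

/-- The stage 1 prediction `V (φ_A(a) ⊗ φ_Z(z))` of `E[ψ_W(W) | A = a, Z = z]`. -/
def pred1 (F : Model 𝒜 𝒵 𝒲 ΘA1 ΘZ ΘA2 ΘW pA pZ qA d) (q : Param1 ΘA1 ΘZ pA pZ d)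
    (a : 𝒜) (z : 𝒵) : Fin d → ℝ :=
  q.V.mulVec (kron (F.φA q.θA a) (F.φZ q.θZ z))

/-- The linear form `v ↦ uᵀ (ψ_A(a) ⊗ v)`. -/
def lin2 (F : Model 𝒜 𝒵 𝒲 ΘA1 ΘZ ΘA2 ΘW pA pZ qA d) (p : Param2 ΘA2 ΘW qA d)
    (a : 𝒜) (v : Fin d → ℝ) : ℝ :=
  p.u ⬝ᵥ kron (F.ψA p.θA a) v

/-- The model of the bridge function, `h(a, w) = uᵀ (ψ_A(a) ⊗ ψ_W(w))`. -/
def bridge (F : Model 𝒜 𝒵 𝒲 ΘA1 ΘZ ΘA2 ΘW pA pZ qA d) (p : Param2 ΘA2 ΘW qA d)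
    (a : 𝒜) (w : 𝒲) : ℝ :=
  F.lin2 p a (F.ψW p.θW w)

/-- The stage 1 loss at one observation. -/
def loss1 (F : Model 𝒜 𝒵 𝒲 ΘA1 ΘZ ΘA2 ΘW pA pZ qA d) (θ : ΘW) (q : Param1 ΘA1 ΘZ pA pZ d)
    (x : 𝒲 × 𝒜 × 𝒵) : ℝ :=
  sqNorm (F.ψW θ x.1 - F.pred1 q x.2.1 x.2.2)

/-- The stage 2 loss at one observation, when `q` is used as the stage 1 solution. -/
def loss2 (F : Model 𝒜 𝒵 𝒲 ΘA1 ΘZ ΘA2 ΘW pA pZ qA d) (p : Param2 ΘA2 ΘW qA d)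
    (q : Param1 ΘA1 ΘZ pA pZ d) (x : ℝ × 𝒜 × 𝒵) : ℝ :=
  (x.1 - F.lin2 p x.2.1 (F.pred1 q x.2.1 x.2.2)) ^ 2

/-- The stage 1 class `H₁`. -/
def class1 (F : Model 𝒜 𝒵 𝒲 ΘA1 ΘZ ΘA2 ΘW pA pZ qA d) : Set (𝒲 × 𝒜 × 𝒵 → ℝ) :=
  {f | ∃ p ∈ F.adm2, ∃ q ∈ F.adm1, f = F.loss1 p.θW q}

/-- The stage 2 class `H₂`. -/
def class2 (F : Model 𝒜 𝒵 𝒲 ΘA1 ΘZ ΘA2 ΘW pA pZ qA d) : Set (ℝ × 𝒜 × 𝒵 → ℝ) :=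
  {f | ∃ p ∈ F.adm2, ∃ q ∈ F.adm1, f = F.loss2 p q}

/-- The (ridge-penalized) empirical stage 1 loss, with target features `ψ_{θ_W}`. -/
noncomputable def empLoss1 (F : Model 𝒜 𝒵 𝒲 ΘA1 ΘZ ΘA2 ΘW pA pZ qA d) {m : ℕ} (lam : ℝ)
    (s : Fin m → 𝒲 × 𝒜 × 𝒵) (θ : ΘW) (q : Param1 ΘA1 ΘZ pA pZ d) : ℝ :=
  (m : ℝ)⁻¹ * ∑ i, F.loss1 θ q (s i) + lam * sqNorm (fun ij : Fin d × _ => q.V ij.1 ij.2)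

/-- The (ridge-penalized) empirical stage 2 loss, where `q θ_W` is the stage 1 solution for the
target features `ψ_{θ_W}`. -/
noncomputable def empLoss2 (F : Model 𝒜 𝒵 𝒲 ΘA1 ΘZ ΘA2 ΘW pA pZ qA d) {n : ℕ} (lam : ℝ)
    (s : Fin n → ℝ × 𝒜 × 𝒵) (q : ΘW → Param1 ΘA1 ΘZ pA pZ d) (p : Param2 ΘA2 ΘW qA d) : ℝ :=
  (n : ℝ)⁻¹ * ∑ i, F.loss2 p (q p.θW) (s i) + lam * sqNorm p.u

/-- `q θ_W` minimizes the empirical stage 1 loss for every admissible `θ_W`. -/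
def IsStage1Solution (F : Model 𝒜 𝒵 𝒲 ΘA1 ΘZ ΘA2 ΘW pA pZ qA d) {m : ℕ} (lam : ℝ)
    (s : Fin m → 𝒲 × 𝒜 × 𝒵) (q : ΘW → Param1 ΘA1 ΘZ pA pZ d) : Prop :=
  ∀ p ∈ F.adm2, q p.θW ∈ F.adm1 ∧
    ∀ q' ∈ F.adm1, F.empLoss1 lam s p.θW (q p.θW) ≤ F.empLoss1 lam s p.θW q'

/-- `p` minimizes the empirical stage 2 loss built from the stage 1 solution `q`. -/
def IsStage2Solution (F : Model 𝒜 𝒵 𝒲 ΘA1 ΘZ ΘA2 ΘW pA pZ qA d) {n : ℕ} (lam : ℝ)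
    (s : Fin n → ℝ × 𝒜 × 𝒵) (q : ΘW → Param1 ΘA1 ΘZ pA pZ d) (p : Param2 ΘA2 ΘW qA d) : Prop :=
  p ∈ F.adm2 ∧ ∀ p' ∈ F.adm2, F.empLoss2 lam s q p ≤ F.empLoss2 lam s q p'

/-- The estimated structural function `a ↦ uᵀ (ψ_A(a) ⊗ (1/k) ∑ i, ψ_W(w i))`. -/
noncomputable def fHat (F : Model 𝒜 𝒵 𝒲 ΘA1 ΘZ ΘA2 ΘW pA pZ qA d) (p : Param2 ΘA2 ΘW qA d)
    {k : ℕ} (w : Fin k → 𝒲) (a : 𝒜) : ℝ :=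
  F.lin2 p a ((k : ℝ)⁻¹ • ∑ i, F.ψW p.θW (w i))

/-- The classes of both stages are pointwise separable: some countable set of admissible
parameters gives functions that approximate, pointwise along a sequence, those of every admissible
parameter. This is automatic when the parameters range over subsets of Euclidean spaces and the
features are continuous in the parameters. -/
def PointwiseSeparable (F : Model 𝒜 𝒵 𝒲 ΘA1 ΘZ ΘA2 ΘW pA pZ qA d) : Prop :=
  (∃ D ⊆ F.adm1, D.Countable ∧ ∀ q ∈ F.adm1, ∃ r : ℕ → Param1 ΘA1 ΘZ pA pZ d,
    (∀ k, r k ∈ D) ∧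
      ∀ a z, Tendsto (fun k => F.pred1 (r k) a z) atTop (𝓝 (F.pred1 q a z))) ∧
  (∃ D ⊆ F.adm2, D.Countable ∧ ∀ p ∈ F.adm2, ∃ r : ℕ → Param2 ΘA2 ΘW qA d,
    (∀ k, r k ∈ D) ∧
      (∀ w, Tendsto (fun k => F.ψW (r k).θW w) atTop (𝓝 (F.ψW p.θW w))) ∧
      ∀ a v, Tendsto (fun k => F.lin2 (r k) a v) atTop (𝓝 (F.lin2 p a v)))

variable {Ω 𝒰 : Type*} [MeasurableSpace Ω] [MeasurableSpace 𝒰]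

/-- The boundedness conditions, with a common constant `M`: the outcome, the stage 1 predictions,
the stage 2 features and the linear forms of stage 2 (on the unit ball) are bounded by `M`. -/
structure BoundedBy (F : Model 𝒜 𝒵 𝒲 ΘA1 ΘZ ΘA2 ΘW pA pZ qA d)
    (P : Population Ω 𝒰 𝒜 𝒵 𝒲) (M : ℝ) : Prop where
  outcome : ∀ᵐ ω ∂P.μ, |P.Y ω| ≤ M
  stage1 : ∀ q ∈ F.adm1, ∀ a z, Real.sqrt (sqNorm (F.pred1 q a z)) ≤ M
  feature : ∀ p ∈ F.adm2, ∀ w, Real.sqrt (sqNorm (F.ψW p.θW w)) ≤ M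
  weight : ∀ p ∈ F.adm2, ∀ a v, sqNorm v ≤ 1 → |F.lin2 p a v| ≤ M

/-- The misspecification error of stage 1,
`κ₁ = sup_{θ_W} inf_{V, θ_{A(1)}, θ_Z} E ‖E[ψ_W(W) | A, Z] - V (φ_A(A) ⊗ φ_Z(Z))‖²`. -/
noncomputable def kappa1 (F : Model 𝒜 𝒵 𝒲 ΘA1 ΘZ ΘA2 ΘW pA pZ qA d)
    (P : Population Ω 𝒰 𝒜 𝒵 𝒲) : ℝ :=
  ⨆ p : F.adm2, ⨅ q : F.adm1,
    ∫ ω, sqNorm (fun i => P.condAZ (fun ω' => F.ψW p.1.θW (P.W ω') i) ω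
      - F.pred1 q.1 (P.A ω) (P.Z ω) i) ∂P.μ

/-- The misspecification error of stage 2,
`κ₂ = inf_{u, θ_{A(2)}, θ_W} ‖E[Y | A, Z] - E[h(A, W) | A, Z]‖` in `L²`. -/
noncomputable def kappa2 (F : Model 𝒜 𝒵 𝒲 ΘA1 ΘZ ΘA2 ΘW pA pZ qA d)
    (P : Population Ω 𝒰 𝒜 𝒵 𝒲) : ℝ :=
  ⨅ p : F.adm2,
    Real.sqrt (∫ ω, (P.condAZ P.Y ω
      - P.condAZ (fun ω' => F.bridge p.1 (P.A ω') (P.W ω')) ω) ^ 2 ∂P.μ)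

/-- The measure of ill-posedness of the bridge equation relative to the bridge model,
`τ = sup_h ‖h - h*‖_{L²(P_{A,W})} / ‖E[(h - h*)(A, W) | A, Z]‖_{L²}`, a value in `[0, ∞]`
(with `0 / 0 = 0` and `c / 0 = ∞` for `c > 0`). -/
noncomputable def illPosedness (F : Model 𝒜 𝒵 𝒲 ΘA1 ΘZ ΘA2 ΘW pA pZ qA d)
    (P : Population Ω 𝒰 𝒜 𝒵 𝒲) (hstar : 𝒜 → 𝒲 → ℝ) : ℝ≥0∞ :=
  ⨆ p ∈ F.adm2,
    eLpNorm (fun ω => F.bridge p (P.A ω) (P.W ω) - hstar (P.A ω) (P.W ω)) 2 P.μ /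
      eLpNorm (P.condAZ (fun ω => F.bridge p (P.A ω) (P.W ω) - hstar (P.A ω) (P.W ω))) 2 P.μ

end Model

end DFPV

/-!
By completeness of `Z` for `U`, every bridge function satisfies
`f_struct a = ∫ hstar a w ∂P_W` for almost every `a`, so the error of `fHat` splits into
`‖h - hstar‖` in `L²(P_A ⊗ P_W)` for the estimated bridge function `h` and the error of the mean of
`h a` over the extra sample, which is of order `1 / √nW` by the variance of an i.i.d. mean. The
support condition moves the first term to `L²(P_{A,W})` and ill-posedness bounds it by
`τ * ‖E[Y | A, Z] - E[h | A, Z]‖`.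

That last norm is the excess risk of two nested least-squares problems. Comparing the estimated
parameters with arbitrary admissible ones in the empirical losses bounds it by the misspecification
plus twice the largest deviation between empirical and true risks over the loss classes; the
stage 1 error enters stage 2 through the bounded linear form `F.lin2`. By symmetrization the
deviation is at most `2 * empRademacher` in mean, and the deviation and the empirical Rademacher
complexity both have bounded differences, so Efron–Stein and Chebyshev control their fluctuations
at the order `1 / √k`.
-/

namespace DFPV

section Variance

variable {α β : Type*} [MeasurableSpace α] [MeasurableSpace β] {μ : Measure α} {ν : Measure β}

lemma sq_integral_le_integral_sq [IsProbabilityMeasure μ] {f : α → ℝ} (hf : MemLp f 2 μ) :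
    (∫ x, f x ∂μ) ^ 2 ≤ ∫ x, f x ^ 2 ∂μ := by
  have h := variance_nonneg f μ
  rw [variance_eq_sub hf] at h
  exact sub_nonneg.mp h

lemma variance_le_of_abs_sub_le [IsProbabilityMeasure μ] {f : α → ℝ} (hf : AEMeasurable f μ) {c : ℝ}
    (hc : ∀ x y, |f x - f y| ≤ c) : Var[f; μ] ≤ (c / 2) ^ 2 := by
  have : Nonempty α := nonempty_of_isProbabilityMeasure μ
  have hle : ∀ x y, f x - c ≤ f y := fun x y => by linarith [le_of_abs_le (hc x y)]
  have hbdd : BddBelow (Set.range f) :=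
    ⟨f (Classical.arbitrary α) - c, Set.forall_mem_range.mpr (hle _)⟩
  have hmem : ∀ x, f x ∈ Set.Icc (⨅ y, f y) ((⨅ y, f y) + c) := fun x =>
    ⟨ciInf_le hbdd x, sub_le_iff_le_add.mp (le_ciInf (hle x))⟩
  simpa using variance_le_sq_of_bounded (ae_of_all μ hmem) hf

lemma ae_memLp_two_section_kernel [SFinite μ] {κ : Kernel α β} [IsSFiniteKernel κ]
    {f : α × β → ℝ} (hf : MemLp f 2 (μ ⊗ₘ κ)) : ∀ᵐ x ∂μ, MemLp (fun y => f (x, y)) 2 (κ x) := by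
  filter_upwards [hf.1.compProd_mk_left, hf.integrable_sq.ae_of_compProd] with x hmeas hint
  exact (memLp_two_iff_integrable_sq hmeas).mpr hint

lemma memLp_two_integral_kernel [SFinite μ] {κ : Kernel α β} [IsMarkovKernel κ]
    {f : α × β → ℝ} (hf : MemLp f 2 (μ ⊗ₘ κ)) : MemLp (fun x => ∫ y, f (x, y) ∂κ x) 2 μ := by
  have hmeas : AEStronglyMeasurable (fun x => ∫ y, f (x, y) ∂κ x) μ :=
    hf.1.integral_kernel_compProd
  refine (memLp_two_iff_integrable_sq hmeas).mpr ?_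
  refine hf.integrable_sq.integral_compProd.mono' (hmeas.pow 2) ?_
  filter_upwards [ae_memLp_two_section_kernel hf] with x hx
  simpa using sq_integral_le_integral_sq hx

lemma ae_memLp_two_section [SFinite μ] [SFinite ν] {f : α × β → ℝ} (hf : MemLp f 2 (μ.prod ν)) :
    ∀ᵐ x ∂μ, MemLp (fun y => f (x, y)) 2 ν :=
  ae_memLp_two_section_kernel (κ := Kernel.const α ν) (by rwa [Measure.compProd_const])

lemma memLp_two_integral_prod_left [SFinite μ] [IsProbabilityMeasure ν] {f : α × β → ℝ}
    (hf : MemLp f 2 (μ.prod ν)) : MemLp (fun x => ∫ y, f (x, y) ∂ν) 2 μ :=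
  memLp_two_integral_kernel (κ := Kernel.const α ν) (by rwa [Measure.compProd_const])

theorem variance_prod [IsProbabilityMeasure μ] [IsProbabilityMeasure ν] {f : α × β → ℝ}
    (hf : MemLp f 2 (μ.prod ν)) :
    Var[f; μ.prod ν]
      = ∫ x, Var[fun y => f (x, y); ν] ∂μ + Var[fun x => ∫ y, f (x, y) ∂ν; μ] := by
  have hmean := memLp_two_integral_prod_left hf
  have hsection : (fun x => Var[fun y => f (x, y); ν])
      =ᵐ[μ] fun x => ∫ y, f (x, y) ^ 2 ∂ν - (∫ y, f (x, y) ∂ν) ^ 2 := by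
    filter_upwards [ae_memLp_two_section hf] with x hx
    exact variance_eq_sub hx
  rw [integral_congr_ae hsection,
    integral_sub hf.integrable_sq.integral_prod_left hmean.integrable_sq,
    variance_eq_sub hmean, variance_eq_sub hf, integral_prod _ (hf.integrable one_le_two)]
  simp only [Pi.pow_apply]
  rw [integral_prod _ hf.integrable_sq]
  ring

end Variance

/-- The bounded differences property: changing only the `i`-th argument changes `f` by at most
`c i`. -/
def HasBoundedDifferences {ι : Type*} [DecidableEq ι] {S : ι → Type*} (f : (∀ i, S i) → ℝ)
    (c : ι → ℝ) : Prop :=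
  ∀ x i y, |f (Function.update x i y) - f x| ≤ c i

namespace HasBoundedDifferences

variable {ι : Type*} [Fintype ι] [DecidableEq ι] {S : ι → Type*} {f : (∀ i, S i) → ℝ}
  {c : ι → ℝ}

lemma abs_sub_le (hf : HasBoundedDifferences f c) (x y : ∀ i, S i) : |f x - f y| ≤ ∑ i, c i := by
  have hpiecewise : ∀ s : Finset ι, |f (s.piecewise x y) - f y| ≤ ∑ i ∈ s, c i := by
    intro s
    induction s using Finset.induction_on with
    | empty => simp
    | insert j s hj ih =>
      rw [Finset.piecewise_insert, Finset.sum_insert hj]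
      exact (_root_.abs_sub_le _ (f (s.piecewise x y)) _).trans (add_le_add (hf _ j _) ih)
  simpa using hpiecewise Finset.univ

lemma memLp_two [∀ i, MeasurableSpace (S i)] (hf : HasBoundedDifferences f c)
    (hfm : Measurable f) (ν : ∀ i, Measure (S i)) [∀ i, IsProbabilityMeasure (ν i)] :
    MemLp f 2 (Measure.pi ν) := by
  obtain ⟨y⟩ := nonempty_of_isProbabilityMeasure (Measure.pi ν)
  refine MemLp.of_bound hfm.aestronglyMeasurable (|f y| + ∑ i, c i) (ae_of_all _ fun x => ?_)
  have h := abs_sub_abs_le_abs_sub (f x) (f y)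
  rw [Real.norm_eq_abs]
  linarith [hf.abs_sub_le x y]

end HasBoundedDifferences

lemma measurePreserving_finCons {k : ℕ} {S : Fin (k + 1) → Type*} [∀ i, MeasurableSpace (S i)]
    (ν : ∀ i, Measure (S i)) [∀ i, SigmaFinite (ν i)] :
    MeasurePreserving (fun x : S 0 × (∀ i : Fin k, S i.succ) => (Fin.cons x.1 x.2 : ∀ i, S i))
      ((ν 0).prod (Measure.pi fun i => ν i.succ)) (Measure.pi ν) := by
  have hsymm := (measurePreserving_piFinSuccAbove ν 0).symm (MeasurableEquiv.piFinSuccAbove S 0)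
  rwa [show ⇑(MeasurableEquiv.piFinSuccAbove S 0).symm
      = fun x : S 0 × (∀ i : Fin k, S i.succ) => (Fin.cons x.1 x.2 : ∀ i, S i) from
    funext fun x => Fin.insertNth_zero x.1 x.2] at hsymm

namespace HasBoundedDifferences

theorem variance_pi_le : ∀ {k : ℕ} {S : Fin k → Type*} [∀ i, MeasurableSpace (S i)]
    {ν : ∀ i, Measure (S i)} [∀ i, IsProbabilityMeasure (ν i)] {f : (∀ i, S i) → ℝ}
    {c : Fin k → ℝ}, HasBoundedDifferences f c → Measurable f →
    Var[f; Measure.pi ν] ≤ ∑ i, (c i / 2) ^ 2 := by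
  intro k
  induction k with
  | zero =>
    intro S _ ν _ f c _ hfm
    have hconst : ∀ x y, |f x - f y| ≤ 0 := fun x y => by simp [Subsingleton.elim x y]
    simpa using variance_le_of_abs_sub_le hfm.aemeasurable hconst
  | succ k ih =>
    intro S _ ν _ f c hf hfm
    let ρ : Measure (∀ i : Fin k, S i.succ) := Measure.pi fun i => ν i.succ
    let g : S 0 × (∀ i : Fin k, S i.succ) → ℝ := fun x => f (Fin.cons x.1 x.2)
    have hcons : MeasurePreserving _ ((ν 0).prod ρ) (Measure.pi ν) := measurePreserving_finCons ν
    have hgm : Measurable g := hfm.comp hcons.measurable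
    have hg : MemLp g 2 ((ν 0).prod ρ) := (hf.memLp_two hfm ν).comp_measurePreserving hcons
    have htail : ∀ a, HasBoundedDifferences (fun b => g (a, b)) fun i => c i.succ := by
      intro a b i y
      simpa only [g, Fin.cons_update] using hf (Fin.cons a b) i.succ y
    have htail_memLp : ∀ a, MemLp (fun b => g (a, b)) 2 ρ := fun a =>
      (htail a).memLp_two (hgm.comp measurable_prodMk_left) _
    have hhead : ∀ a a', |∫ b, g (a, b) ∂ρ - ∫ b, g (a', b) ∂ρ| ≤ c 0 := by
      intro a a'
      rw [← integral_sub ((htail_memLp a).integrable one_le_two)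
        ((htail_memLp a').integrable one_le_two)]
      have hle : ∀ b, ‖g (a, b) - g (a', b)‖ ≤ c 0 := fun b => by
        simpa only [g, Real.norm_eq_abs, Fin.update_cons_zero] using hf (Fin.cons a' b) 0 a
      simpa using norm_integral_le_of_norm_le_const (μ := ρ) (ae_of_all _ hle)
    have hsection : ∫ a, Var[fun b => g (a, b); ρ] ∂ν 0 ≤ ∑ i : Fin k, (c i.succ / 2) ^ 2 := by
      have hle : ∀ a, Var[fun b => g (a, b); ρ] ≤ ∑ i : Fin k, (c i.succ / 2) ^ 2 := fun a =>
        ih (htail a) (hgm.comp measurable_prodMk_left)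
      refine (integral_mono_of_nonneg (ae_of_all _ fun a => variance_nonneg _ _)
        (integrable_const _) (ae_of_all _ hle)).trans_eq ?_
      rw [integral_const, probReal_univ, one_smul]
    rw [← hcons.variance_fun_comp hfm.aemeasurable, variance_prod hg, Fin.sum_univ_succ,
      add_comm]
    refine add_le_add (variance_le_of_abs_sub_le ?_ hhead) hsection
    exact (memLp_two_integral_prod_left hg).1.aemeasurable

variable {k : ℕ} {S : Fin k → Type*} [∀ i, MeasurableSpace (S i)] {ν : ∀ i, Measure (S i)}
  [∀ i, IsProbabilityMeasure (ν i)] {f : (∀ i, S i) → ℝ} {c : Fin k → ℝ}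

theorem measure_ge_le (hf : HasBoundedDifferences f c) (hfm : Measurable f) {t : ℝ}
    (ht : 0 < t) :
    Measure.pi ν {x | t ≤ |f x - ∫ y, f y ∂Measure.pi ν|}
      ≤ ENNReal.ofReal ((∑ i, (c i / 2) ^ 2) / t ^ 2) := by
  refine (meas_ge_le_variance_div_sq (hf.memLp_two hfm ν) ht).trans ?_
  gcongr
  exact hf.variance_pi_le hfm

end HasBoundedDifferences

section Suprema

variable {ι : Type*} {f g : ι → ℝ} {B : ℝ}

lemma bddAbove_range_of_abs_le (hf : ∀ i, |f i| ≤ B) : BddAbove (Set.range f) :=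
  ⟨B, Set.forall_mem_range.mpr fun i => le_of_abs_le (hf i)⟩

lemma abs_iSup_le (hB : 0 ≤ B) (hf : ∀ i, |f i| ≤ B) : |⨆ i, f i| ≤ B := by
  rcases isEmpty_or_nonempty ι with _ | ⟨⟨i⟩⟩
  · simpa using hB
  · exact abs_le.mpr ⟨(neg_le_of_abs_le (hf i)).trans (le_ciSup (bddAbove_range_of_abs_le hf) i),
      Real.iSup_le (fun j => le_of_abs_le (hf j)) hB⟩

lemma iSup_sub_iSup_le (hg : BddAbove (Set.range g)) (hB : 0 ≤ B) (h : ∀ i, f i - g i ≤ B) :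
    (⨆ i, f i) - ⨆ i, g i ≤ B := by
  rcases isEmpty_or_nonempty ι with _ | _
  · simpa using hB
  · rw [sub_le_iff_le_add]
    exact ciSup_le fun i => (sub_le_iff_le_add.mp (h i)).trans (by gcongr; exact le_ciSup hg i)

lemma HasBoundedDifferences.iSup {κ : Type*} [DecidableEq κ] {S : κ → Type*}
    {f : ι → (∀ i, S i) → ℝ} {c : κ → ℝ} (hf : ∀ j, HasBoundedDifferences (f j) c)
    (hc : ∀ i, 0 ≤ c i) (hbdd : ∀ x, BddAbove (Set.range fun j => f j x)) :
    HasBoundedDifferences (fun x => ⨆ j, f j x) c := fun x i y =>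
  abs_sub_le_iff.mpr
    ⟨iSup_sub_iSup_le (hbdd _) (hc i) fun j => le_of_abs_le (hf j x i y),
      iSup_sub_iSup_le (hbdd _) (hc i) fun j =>
        le_of_abs_le ((abs_sub_comm _ _).trans_le (hf j x i y))⟩

end Suprema

section SignedMean

variable {k : ℕ}

/-- The mean of the numbers `a i`, with the signs prescribed by `σ` (`true` standing for `+`). -/
noncomputable def signedMean (σ : Fin k → Bool) (a : Fin k → ℝ) : ℝ :=
  (k : ℝ)⁻¹ * ∑ i, (if σ i then (1 : ℝ) else -1) * a i

lemma signedMean_sub (σ : Fin k → Bool) (a b : Fin k → ℝ) :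
    signedMean σ (fun i => a i - b i) = signedMean σ a - signedMean σ b := by
  simp only [signedMean, mul_sub, Finset.sum_sub_distrib]

lemma signedMean_not (σ : Fin k → Bool) (a : Fin k → ℝ) :
    signedMean (fun i => !σ i) a = -signedMean σ a := by
  rw [signedMean, signedMean, ← mul_neg, ← Finset.sum_neg_distrib]
  refine congrArg _ (Finset.sum_congr rfl fun i _ => ?_)
  cases σ i <;> simp

lemma signedMean_neg (σ : Fin k → Bool) (a : Fin k → ℝ) :
    signedMean σ (fun i => -a i) = -signedMean σ a := by
  simp only [signedMean, mul_neg, Finset.sum_neg_distrib]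

lemma signedMean_true (a : Fin k → ℝ) :
    signedMean (fun _ => true) a = (k : ℝ)⁻¹ * ∑ i, a i := by
  simp only [signedMean, if_true, one_mul]

lemma abs_sign_mul (b : Bool) (x : ℝ) : |(if b then (1 : ℝ) else -1) * x| = |x| := by
  cases b <;> simp

lemma abs_signedMean_le {B : ℝ} (hB : 0 ≤ B) {a : Fin k → ℝ} (ha : ∀ i, |a i| ≤ B)
    (σ : Fin k → Bool) : |signedMean σ a| ≤ B := by
  rcases Nat.eq_zero_or_pos k with rfl | hk
  · simpa [signedMean] using hB
  have hk' : (0 : ℝ) < k := Nat.cast_pos.mpr hk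
  rw [signedMean, abs_mul, abs_of_pos (inv_pos.mpr hk'), inv_mul_le_iff₀ hk']
  calc |∑ i, (if σ i then (1 : ℝ) else -1) * a i|
      ≤ ∑ i, |(if σ i then (1 : ℝ) else -1) * a i| := Finset.abs_sum_le_sum_abs _ _
    _ ≤ ∑ _i : Fin k, B := Finset.sum_le_sum fun i _ => (abs_sign_mul _ _).trans_le (ha i)
    _ = k * B := by simp

lemma abs_signedMean_update_sub (σ : Fin k → Bool) (a : Fin k → ℝ) (j : Fin k) (y : ℝ) :
    |signedMean σ (Function.update a j y) - signedMean σ a| = |y - a j| / k := by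
  rw [← signedMean_sub, signedMean, Finset.sum_eq_single_of_mem j (Finset.mem_univ j), abs_mul,
    abs_sign_mul, abs_of_nonneg (by positivity), Function.update_self, inv_mul_eq_div]
  intro i _ hi
  simp [Function.update_of_ne hi]

lemma HasBoundedDifferences.signedMean {S : Type*} {h : S → ℝ} {B : ℝ} (hB : ∀ x, |h x| ≤ B)
    (σ : Fin k → Bool) :
    HasBoundedDifferences (fun s : Fin k → S => signedMean σ fun i => h (s i))
      fun _ => 2 * B / k := by
  intro s j y
  have hupdate : (fun i => h (Function.update s j y i))
      = Function.update (fun i => h (s i)) j (h y) :=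
    Function.comp_update h s j y
  have hle : |h y - h (s j)| ≤ 2 * B := by
    linarith [abs_sub (h y) (h (s j)), hB y, hB (s j)]
  simp only [hupdate, abs_signedMean_update_sub]
  gcongr

end SignedMean

section Rademacher

variable {S : Type*} {k : ℕ} {D : Set (S → ℝ)} {B : ℝ}

/-- The largest mean of a function of the class `D` over the sample `s` with signs `σ`. -/
noncomputable def signedSup (D : Set (S → ℝ)) (σ : Fin k → Bool) (s : Fin k → S) : ℝ :=
  ⨆ h : D, signedMean σ fun i => h.1 (s i)

lemma empRademacher_eq_sum_signedSup (D : Set (S → ℝ)) (s : Fin k → S) :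
    empRademacher D s = ((2 : ℝ) ^ k)⁻¹ * ∑ σ : Fin k → Bool, signedSup D σ s := rfl

lemma sum_comp_not (a : (Fin k → Bool) → ℝ) :
    ∑ σ : Fin k → Bool, a (fun i => !σ i) = ∑ σ, a σ :=
  Equiv.sum_comp (Equiv.arrowCongr (Equiv.refl _) Equiv.boolNot) a

lemma abs_signAverage_le {a : (Fin k → Bool) → ℝ} {c : ℝ} (ha : ∀ σ, |a σ| ≤ c) :
    |((2 : ℝ) ^ k)⁻¹ * ∑ σ : Fin k → Bool, a σ| ≤ c := by
  rw [abs_mul, abs_of_pos (by positivity), inv_mul_le_iff₀ (by positivity)]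
  calc |∑ σ, a σ| ≤ ∑ σ, |a σ| := Finset.abs_sum_le_sum_abs _ _
    _ ≤ ∑ _σ : Fin k → Bool, c := Finset.sum_le_sum fun σ _ => ha σ
    _ = 2 ^ k * c := by simp

lemma signedSup_neg_image (D : Set (S → ℝ)) (σ : Fin k → Bool) (s : Fin k → S) :
    signedSup ((fun g => -g) '' D) σ s = signedSup D (fun i => !σ i) s := by
  refine (((Equiv.neg (S → ℝ)).image D).iSup_congr fun h => ?_).symm
  exact (signedMean_neg σ _).trans (signedMean_not σ _).symm

lemma empRademacher_neg_image (D : Set (S → ℝ)) (s : Fin k → S) :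
    empRademacher ((fun g => -g) '' D) s = empRademacher D s := by
  simp only [empRademacher_eq_sum_signedSup, signedSup_neg_image,
    sum_comp_not fun σ => signedSup D σ s]

lemma signedMean_le_signedSup (hB : 0 ≤ B) {s : Fin k → S} (hs : ∀ h ∈ D, ∀ i, |h (s i)| ≤ B)
    (σ : Fin k → Bool) {h : S → ℝ} (hh : h ∈ D) :
    signedMean σ (fun i => h (s i)) ≤ signedSup D σ s :=
  le_ciSup (f := fun h : D => signedMean σ fun i => h.1 (s i))
    (bddAbove_range_of_abs_le fun h => abs_signedMean_le hB (hs h.1 h.2) σ) ⟨h, hh⟩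

lemma empRademacher_nonneg (hB : 0 ≤ B) {s : Fin k → S} (hs : ∀ h ∈ D, ∀ i, |h (s i)| ≤ B) :
    0 ≤ empRademacher D s := by
  rcases D.eq_empty_or_nonempty with rfl | ⟨h, hh⟩
  · simp [empRademacher]
  have hpair : 0 ≤ ∑ σ : Fin k → Bool, (signedSup D σ s + signedSup D (fun i => !σ i) s) := by
    refine Finset.sum_nonneg fun σ _ => ?_
    have hσ := signedMean_le_signedSup hB hs σ hh
    have hnot := signedMean_le_signedSup hB hs (fun i => !σ i) hh
    rw [signedMean_not] at hnot
    linarith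
  rw [Finset.sum_add_distrib, sum_comp_not fun σ => signedSup D σ s] at hpair
  rw [empRademacher_eq_sum_signedSup]
  exact mul_nonneg (by positivity) (by linarith)

lemma empRademacher_indicator_image_le {H : Set (S → ℝ)} {T : Set S} {s : Fin k → S}
    (hs : ∀ i, s i ∈ T) (hDH : D ⊆ H) (hB₀ : 0 ≤ B) (hB : ∀ h ∈ H, ∀ x ∈ T, |h x| ≤ B) :
    empRademacher (T.indicator '' D) s ≤ empRademacher H s := by
  rcases D.eq_empty_or_nonempty with rfl | hD
  · simpa [empRademacher] using empRademacher_nonneg hB₀ fun h hh i => hB h hh _ (hs i)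
  have : Nonempty (T.indicator '' D) := (hD.image _).to_subtype
  rw [empRademacher_eq_sum_signedSup, empRademacher_eq_sum_signedSup]
  gcongr with σ
  refine ciSup_le fun h => ?_
  obtain ⟨g, hg, hgh⟩ := h.2
  simpa only [← hgh, Set.indicator_of_mem (hs _)] using
    signedMean_le_signedSup hB₀ (fun h hh i => hB h hh _ (hs i)) σ (hDH hg)

lemma measurable_signedSup [MeasurableSpace S] (hc : D.Countable) (hm : ∀ h ∈ D, Measurable h)
    (σ : Fin k → Bool) : Measurable (signedSup D σ) := by
  have : Countable D := hc.to_subtype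
  refine Measurable.iSup fun h => ?_
  have := hm h.1 h.2
  unfold signedMean
  fun_prop

lemma measurable_empRademacher [MeasurableSpace S] (hc : D.Countable)
    (hm : ∀ h ∈ D, Measurable h) : Measurable (empRademacher (k := k) D) :=
  (Finset.measurable_sum _ fun σ _ => measurable_signedSup hc hm σ).const_mul _

lemma abs_signedSup_le (hB₀ : 0 ≤ B) (hB : ∀ h ∈ D, ∀ x, |h x| ≤ B) (σ : Fin k → Bool)
    (s : Fin k → S) : |signedSup D σ s| ≤ B :=
  abs_iSup_le hB₀ fun h => abs_signedMean_le hB₀ (fun i => hB h.1 h.2 (s i)) σ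

lemma HasBoundedDifferences.empRademacher (hB₀ : 0 ≤ B) (hB : ∀ h ∈ D, ∀ x, |h x| ≤ B) :
    HasBoundedDifferences (empRademacher (k := k) D) fun _ => 2 * B / k := by
  have hsup : ∀ σ : Fin k → Bool, HasBoundedDifferences (signedSup D σ) fun _ => 2 * B / k :=
    fun σ => HasBoundedDifferences.iSup (fun h : D => .signedMean (hB h.1 h.2) σ)
      (fun _ => by positivity) fun s =>
        bddAbove_range_of_abs_le fun h => abs_signedMean_le hB₀ (fun i => hB h.1 h.2 (s i)) σ
  intro s j y
  rw [empRademacher_eq_sum_signedSup, empRademacher_eq_sum_signedSup, ← mul_sub,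
    ← Finset.sum_sub_distrib]
  exact abs_signAverage_le fun σ => hsup σ s j y

end Rademacher

lemma abs_integral_le_of_abs_le {α : Type*} [MeasurableSpace α] {μ : Measure α}
    [IsProbabilityMeasure μ] {f : α → ℝ} {B : ℝ} (hf : ∀ᵐ x ∂μ, |f x| ≤ B) :
    |∫ x, f x ∂μ| ≤ B := by
  simpa using norm_integral_le_of_norm_le_const (μ := μ) (f := f) (C := B) hf

section Symmetrization

lemma abs_sampleMean_le {k : ℕ} {B : ℝ} (hB₀ : 0 ≤ B) {a : Fin k → ℝ} (ha : ∀ i, |a i| ≤ B) :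
    |(k : ℝ)⁻¹ * ∑ i, a i| ≤ B := by
  simpa only [signedMean_true] using abs_signedMean_le hB₀ ha fun _ => true

variable {S : Type*} {k : ℕ} {D : Set (S → ℝ)} {B : ℝ}

lemma abs_signedMean_sub_le (hB₀ : 0 ≤ B) {h : S → ℝ} (hB : ∀ x, |h x| ≤ B) (σ : Fin k → Bool)
    (x : (Fin k → S) × (Fin k → S)) : |signedMean σ fun i => h (x.2 i) - h (x.1 i)| ≤ 2 * B :=
  abs_signedMean_le (by positivity)
    (fun i => by linarith [abs_sub (h (x.2 i)) (h (x.1 i)), hB (x.2 i), hB (x.1 i)]) σ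

/-- The largest signed mean, over the class `D`, of the differences between two samples: the
expectations in `deviationSup` are replaced by means over a second (ghost) sample. -/
noncomputable def symmetrizedSup (D : Set (S → ℝ)) (σ : Fin k → Bool)
    (x : (Fin k → S) × (Fin k → S)) : ℝ :=
  ⨆ h : D, signedMean σ fun i => h.1 (x.2 i) - h.1 (x.1 i)

lemma symmetrizedSup_le (hB₀ : 0 ≤ B) (hB : ∀ h ∈ D, ∀ x, |h x| ≤ B) (σ : Fin k → Bool)
    (x : (Fin k → S) × (Fin k → S)) :
    symmetrizedSup D σ x ≤ signedSup D σ x.2 + signedSup D (fun i => !σ i) x.1 := by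
  rcases isEmpty_or_nonempty D with _ | _
  · simp [signedSup, symmetrizedSup]
  refine ciSup_le fun h => ?_
  rw [signedMean_sub, sub_eq_add_neg, ← signedMean_not]
  exact add_le_add (signedMean_le_signedSup hB₀ (fun h hh i => hB h hh _) _ h.2)
    (signedMean_le_signedSup hB₀ (fun h hh i => hB h hh _) _ h.2)

variable [MeasurableSpace S] {ν : Measure S}

/-- The law of `k` independent observations with law `ν`. -/
noncomputable abbrev iidLaw (ν : Measure S) (k : ℕ) : Measure (Fin k → S) :=
  Measure.pi fun _ => ν

lemma integral_sampleMean_iidLaw [IsProbabilityMeasure ν] (hk : 0 < k) {f : S → ℝ}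
    (hf : Integrable f ν) :
    ∫ s : Fin k → S, (k : ℝ)⁻¹ * ∑ i, f (s i) ∂iidLaw ν k = ∫ x, f x ∂ν := by
  have hcoord : ∀ i : Fin k, Integrable (fun s : Fin k → S => f (s i)) (iidLaw ν k) := fun i =>
    (measurePreserving_eval (fun _ => ν) i).integrable_comp_of_integrable hf
  have hk' : (k : ℝ) ≠ 0 := Nat.cast_ne_zero.mpr hk.ne'
  rw [integral_const_mul, integral_finsetSum _ fun i _ => hcoord i]
  simp only [integral_comp_eval (μ := fun _ : Fin k => ν) hf.1, Finset.sum_const,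
    Finset.card_univ, Fintype.card_fin, nsmul_eq_mul, inv_mul_cancel_left₀ hk']

/-- The largest excess of the expectation of a function of the class `D` over its mean on the
sample `s`. -/
noncomputable def deviationSup (ν : Measure S) (D : Set (S → ℝ)) (s : Fin k → S) : ℝ :=
  ⨆ h : D, (∫ x, h.1 x ∂ν - (k : ℝ)⁻¹ * ∑ i, h.1 (s i))

lemma measurable_deviationSup (hc : D.Countable) (hm : ∀ h ∈ D, Measurable h) :
    Measurable (deviationSup (k := k) ν D) := by
  have : Countable D := hc.to_subtype
  refine Measurable.iSup fun h => ?_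
  have := hm h.1 h.2
  fun_prop

lemma measurable_symmetrizedSup (hc : D.Countable) (hm : ∀ h ∈ D, Measurable h)
    (σ : Fin k → Bool) : Measurable (symmetrizedSup D σ) := by
  have : Countable D := hc.to_subtype
  refine Measurable.iSup fun h => ?_
  have := hm h.1 h.2
  unfold signedMean
  fun_prop

variable [IsProbabilityMeasure ν]

lemma abs_deviation_le (hB₀ : 0 ≤ B) {h : S → ℝ} (hB : ∀ x, |h x| ≤ B) (s : Fin k → S) :
    |∫ x, h x ∂ν - (k : ℝ)⁻¹ * ∑ i, h (s i)| ≤ 2 * B := by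
  have hmean : |∫ x, h x ∂ν| ≤ B := abs_integral_le_of_abs_le (ae_of_all _ hB)
  have hsample := abs_sampleMean_le hB₀ fun i => hB (s i)
  linarith [abs_sub (∫ x, h x ∂ν) ((k : ℝ)⁻¹ * ∑ i, h (s i))]

lemma deviation_le_deviationSup (hB₀ : 0 ≤ B) (hB : ∀ h ∈ D, ∀ x, |h x| ≤ B) {h : S → ℝ}
    (hh : h ∈ D) (s : Fin k → S) :
    ∫ x, h x ∂ν - (k : ℝ)⁻¹ * ∑ i, h (s i) ≤ deviationSup ν D s :=
  le_ciSup (f := fun h : D => ∫ x, h.1 x ∂ν - (k : ℝ)⁻¹ * ∑ i, h.1 (s i))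
    (bddAbove_range_of_abs_le fun h => abs_deviation_le hB₀ (hB h.1 h.2) s) ⟨h, hh⟩

lemma HasBoundedDifferences.deviationSup (hB₀ : 0 ≤ B) (hB : ∀ h ∈ D, ∀ x, |h x| ≤ B) :
    HasBoundedDifferences (deviationSup (k := k) ν D) fun _ => 2 * B / k := by
  refine HasBoundedDifferences.iSup (fun h s j y => ?_) (fun _ => by positivity) fun s =>
    bddAbove_range_of_abs_le fun h => abs_deviation_le hB₀ (hB h.1 h.2) s
  rw [sub_sub_sub_cancel_left, abs_sub_comm]
  simpa only [signedMean_true] using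
    HasBoundedDifferences.signedMean (hB h.1 h.2) (fun _ => true) s j y

lemma integrable_symmetrizedSup (hc : D.Countable) (hm : ∀ h ∈ D, Measurable h) (hB₀ : 0 ≤ B)
    (hB : ∀ h ∈ D, ∀ x, |h x| ≤ B) (σ : Fin k → Bool)
    (ρ : Measure ((Fin k → S) × (Fin k → S))) [IsFiniteMeasure ρ] :
    Integrable (symmetrizedSup D σ) ρ :=
  .of_bound (measurable_symmetrizedSup hc hm σ).aestronglyMeasurable (2 * B)
    (ae_of_all _ fun x => abs_iSup_le (by positivity)
      fun h => abs_signedMean_sub_le hB₀ (hB h.1 h.2) σ x)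

lemma integrable_signedSup (hc : D.Countable) (hm : ∀ h ∈ D, Measurable h) (hB₀ : 0 ≤ B)
    (hB : ∀ h ∈ D, ∀ x, |h x| ≤ B) (σ : Fin k → Bool) (ρ : Measure (Fin k → S))
    [IsFiniteMeasure ρ] : Integrable (signedSup D σ) ρ :=
  .of_bound (measurable_signedSup hc hm σ).aestronglyMeasurable B
    (ae_of_all _ fun s => abs_signedSup_le hB₀ hB σ s)

lemma deviationSup_le_integral_symmetrizedSup (hk : 0 < k) (hc : D.Countable)
    (hm : ∀ h ∈ D, Measurable h) (hB₀ : 0 ≤ B) (hB : ∀ h ∈ D, ∀ x, |h x| ≤ B)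
    (s : Fin k → S) :
    deviationSup ν D s ≤ ∫ s', symmetrizedSup D (fun _ => true) (s, s') ∂iidLaw ν k := by
  rcases isEmpty_or_nonempty D with _ | _
  · simp [deviationSup, symmetrizedSup]
  have hsup : Integrable (fun s' => symmetrizedSup D (fun _ => true) (s, s')) (iidLaw ν k) :=
    .of_bound ((measurable_symmetrizedSup hc hm _).comp
      measurable_prodMk_left).aestronglyMeasurable (2 * B) (ae_of_all _ fun s' =>
        abs_iSup_le (by positivity) fun h => abs_signedMean_sub_le hB₀ (hB h.1 h.2) _ (s, s'))
  refine ciSup_le fun h => ?_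
  have hint : Integrable h.1 ν :=
    .of_bound (hm h.1 h.2).aestronglyMeasurable B (ae_of_all _ (hB h.1 h.2))
  have hmean : Integrable (fun s' : Fin k → S => (k : ℝ)⁻¹ * ∑ i, h.1 (s' i)) (iidLaw ν k) :=
    (integrable_finsetSum _ fun i _ =>
      (measurePreserving_eval (fun _ => ν) i).integrable_comp_of_integrable hint).const_mul _
  have hdiff : ∫ x, h.1 x ∂ν - (k : ℝ)⁻¹ * ∑ i, h.1 (s i)
      = ∫ s', ((k : ℝ)⁻¹ * ∑ i, h.1 (s' i) - (k : ℝ)⁻¹ * ∑ i, h.1 (s i)) ∂iidLaw ν k := by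
    rw [integral_sub hmean (integrable_const _), integral_sampleMean_iidLaw hk hint,
      integral_const, probReal_univ, one_smul]
  rw [hdiff]
  refine integral_mono (hmean.sub (integrable_const _)) hsup fun s' => ?_
  simpa only [signedMean_sub, signedMean_true, symmetrizedSup] using
    le_ciSup (f := fun h : D => signedMean (fun _ => true) fun i => h.1 (s' i) - h.1 (s i))
      (bddAbove_range_of_abs_le fun h => abs_signedMean_sub_le hB₀ (hB h.1 h.2) _ (s, s')) h

lemma measurePreserving_swap_coordinates (σ : Fin k → Bool) :
    MeasurePreserving (fun x : (Fin k → S) × (Fin k → S) =>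
        ((fun i => if σ i then x.1 i else x.2 i), fun i => if σ i then x.2 i else x.1 i))
      ((iidLaw ν k).prod (iidLaw ν k)) ((iidLaw ν k).prod (iidLaw ν k)) := by
  have hzip := measurePreserving_arrowProdEquivProdArrow S S (Fin k) (fun _ => ν) fun _ => ν
  have hcoord : ∀ i, MeasurePreserving (fun x : S × S => if σ i then x else x.swap)
      (ν.prod ν) (ν.prod ν) := by
    intro i
    cases σ i
    · exact Measure.measurePreserving_swap
    · exact .id _
  convert hzip.comp ((measurePreserving_pi _ _ hcoord).comp (hzip.symm _)) using 1
  funext x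
  ext i <;> cases h : σ i <;>
    simp [h, MeasurableEquiv.arrowProdEquivProdArrow, Equiv.arrowProdEquivProdArrow]

lemma integral_symmetrizedSup_eq (hc : D.Countable) (hm : ∀ h ∈ D, Measurable h)
    (σ : Fin k → Bool) :
    ∫ x, symmetrizedSup D σ x ∂(iidLaw ν k).prod (iidLaw ν k)
      = ∫ x, symmetrizedSup (k := k) D (fun _ => true) x ∂(iidLaw ν k).prod (iidLaw ν k) := by
  have hswap := measurePreserving_swap_coordinates (ν := ν) σ
  rw [← hswap.map_eq, integral_map hswap.aemeasurable
    (measurable_symmetrizedSup hc hm _).aestronglyMeasurable, hswap.map_eq]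
  refine integral_congr_ae (ae_of_all _ fun x => iSup_congr fun h => ?_)
  refine congrArg _ (Finset.sum_congr rfl fun i _ => ?_)
  cases hi : σ i <;> simp [hi]

lemma integral_symmetrizedSup_le (hc : D.Countable) (hm : ∀ h ∈ D, Measurable h)
    (hB₀ : 0 ≤ B) (hB : ∀ h ∈ D, ∀ x, |h x| ≤ B) (σ : Fin k → Bool) :
    ∫ x, symmetrizedSup D σ x ∂(iidLaw ν k).prod (iidLaw ν k)
      ≤ ∫ s, signedSup D σ s ∂iidLaw ν k + ∫ s, signedSup D (fun i => !σ i) s ∂iidLaw ν k := by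
  have hsnd := (integrable_signedSup hc hm hB₀ hB σ (iidLaw ν k)).comp_snd (iidLaw ν k)
  have hfst := (integrable_signedSup hc hm hB₀ hB (fun i => !σ i) (iidLaw ν k)).comp_fst
    (iidLaw ν k)
  calc ∫ x, symmetrizedSup D σ x ∂(iidLaw ν k).prod (iidLaw ν k)
      ≤ ∫ x, (signedSup D σ x.2 + signedSup D (fun i => !σ i) x.1)
          ∂(iidLaw ν k).prod (iidLaw ν k) :=
        integral_mono (integrable_symmetrizedSup hc hm hB₀ hB σ _) (hsnd.add hfst)
          (symmetrizedSup_le hB₀ hB σ)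
    _ = _ := by
        rw [integral_add hsnd hfst, integral_fun_snd, integral_fun_fst]
        simp only [probReal_univ, one_smul]

theorem integral_deviationSup_le (hk : 0 < k) (hc : D.Countable) (hm : ∀ h ∈ D, Measurable h)
    (hB₀ : 0 ≤ B) (hB : ∀ h ∈ D, ∀ x, |h x| ≤ B) :
    ∫ s, deviationSup ν D s ∂iidLaw ν k ≤ 2 * ∫ s, empRademacher D s ∂iidLaw ν k := by
  have hsup := integrable_symmetrizedSup hc hm hB₀ hB (fun _ => true)
    ((iidLaw ν k).prod (iidLaw ν k))
  have hdev : Integrable (deviationSup ν D) (iidLaw ν k) :=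
    .of_bound (measurable_deviationSup hc hm).aestronglyMeasurable (2 * B)
      (ae_of_all _ fun s => abs_iSup_le (by positivity)
        fun h => abs_deviation_le hB₀ (hB h.1 h.2) s)
  have hghost : ∫ s, deviationSup ν D s ∂iidLaw ν k
      ≤ ∫ x, symmetrizedSup D (fun _ => true) x ∂(iidLaw ν k).prod (iidLaw ν k) := by
    rw [integral_prod _ hsup]
    exact integral_mono hdev hsup.integral_prod_left
      (deviationSup_le_integral_symmetrizedSup hk hc hm hB₀ hB)
  have hcard : ((2 : ℝ) ^ k)⁻¹ * ∑ _σ : Fin k → Bool,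
      ∫ x, symmetrizedSup D (fun _ => true) x ∂(iidLaw ν k).prod (iidLaw ν k)
      = ∫ x, symmetrizedSup D (fun _ => true) x ∂(iidLaw ν k).prod (iidLaw ν k) := by simp
  simp only [empRademacher_eq_sum_signedSup]
  rw [integral_const_mul, integral_finsetSum _ fun σ _ => integrable_signedSup hc hm hB₀ hB σ _]
  calc ∫ s, deviationSup ν D s ∂iidLaw ν k
      ≤ ((2 : ℝ) ^ k)⁻¹ * ∑ _σ : Fin k → Bool,
          ∫ x, symmetrizedSup D (fun _ => true) x ∂(iidLaw ν k).prod (iidLaw ν k) :=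
        hghost.trans_eq hcard.symm
    _ ≤ ((2 : ℝ) ^ k)⁻¹ * ∑ σ : Fin k → Bool, (∫ s, signedSup D σ s ∂iidLaw ν k
          + ∫ s, signedSup D (fun i => !σ i) s ∂iidLaw ν k) := by
        gcongr with σ
        exact (integral_symmetrizedSup_eq hc hm σ).symm.trans_le
          (integral_symmetrizedSup_le hc hm hB₀ hB σ)
    _ = 2 * (((2 : ℝ) ^ k)⁻¹ * ∑ σ : Fin k → Bool, ∫ s, signedSup D σ s ∂iidLaw ν k) := by
        rw [Finset.sum_add_distrib, sum_comp_not fun σ => ∫ s, signedSup D σ s ∂iidLaw ν k]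
        ring

end Symmetrization

section UniformDeviation

variable {S : Type*} [MeasurableSpace S] {ν : Measure S} {k : ℕ} {D H : Set (S → ℝ)} {B t : ℝ}

/-- A class of functions all of which are pointwise limits of sequences of measurable functions
taken from one countable subclass, so that suprema over the class reduce to countable ones. -/
def IsSeparableClass (H : Set (S → ℝ)) : Prop :=
  ∃ D ⊆ H, D.Countable ∧ (∀ h ∈ D, Measurable h) ∧
    ∀ h ∈ H, ∃ r : ℕ → S → ℝ, (∀ j, r j ∈ D) ∧ ∀ x, Tendsto (fun j => r j x) atTop (𝓝 (h x))

lemma isSeparableClass_image {ι : Type*} {Φ : ι → S → ℝ} {I J : Set ι} (hJI : J ⊆ I)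
    (hJ : J.Countable) (hm : ∀ j ∈ J, Measurable (Φ j))
    (hd : ∀ i ∈ I, ∃ r : ℕ → ι, (∀ k, r k ∈ J) ∧
      ∀ x, Tendsto (fun k => Φ (r k) x) atTop (𝓝 (Φ i x))) :
    IsSeparableClass (Φ '' I) := by
  refine ⟨Φ '' J, Set.image_mono hJI, hJ.image _, Set.forall_mem_image.2 hm,
    Set.forall_mem_image.2 fun i hi => ?_⟩
  obtain ⟨r, hr, hl⟩ := hd i hi
  exact ⟨fun k => Φ (r k), fun k => Set.mem_image_of_mem Φ (hr k), hl⟩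

/-- The sample `s` is representative of the law `ν` for the class `H`: uniformly over `H`, sample
means differ from expectations by at most twice the empirical Rademacher complexity, up to an
error of order `t / √k`. Nonnegativity of the complexity, which is a supremum in `ℝ` and has a
junk value when it is infinite, is part of the notion. -/
def IsRepresentative (ν : Measure S) (H : Set (S → ℝ)) (t : ℝ) (s : Fin k → S) : Prop :=
  0 ≤ empRademacher H s ∧ ∀ h ∈ H,
    |∫ x, h x ∂ν - (k : ℝ)⁻¹ * ∑ i, h (s i)| ≤ 2 * empRademacher H s + 3 * (t / √k)

variable [IsProbabilityMeasure ν]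

lemma HasBoundedDifferences.measure_iidLaw_ge_le {f : (Fin k → S) → ℝ} (hk : 0 < k)
    (hf : HasBoundedDifferences f fun _ => 2 * B / k) (hfm : Measurable f) (ht : 0 < t) :
    iidLaw ν k {s | t / √k ≤ |f s - ∫ s, f s ∂iidLaw ν k|} ≤ ENNReal.ofReal (B ^ 2 / t ^ 2) := by
  have hk' : (0 : ℝ) < k := Nat.cast_pos.mpr hk
  convert hf.measure_ge_le (ν := fun _ => ν) hfm (div_pos ht (Real.sqrt_pos.mpr hk')) using 2
  rw [Finset.sum_const, Finset.card_univ, Fintype.card_fin, nsmul_eq_mul, div_pow t,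
    Real.sq_sqrt hk'.le]
  field_simp

theorem measure_deviationSup_gt_le (hk : 0 < k) (hc : D.Countable) (hm : ∀ h ∈ D, Measurable h)
    (hB₀ : 0 ≤ B) (hB : ∀ h ∈ D, ∀ x, |h x| ≤ B) (ht : 0 < t) :
    iidLaw ν k {s | 2 * empRademacher D s + 3 * (t / √k) < deviationSup ν D s}
      ≤ ENNReal.ofReal (2 * (B ^ 2 / t ^ 2)) := by
  have hdev := (HasBoundedDifferences.deviationSup (ν := ν) hB₀ hB).measure_iidLaw_ge_le (ν := ν) hk
    (measurable_deviationSup hc hm) ht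
  have hrad := (HasBoundedDifferences.empRademacher hB₀ hB).measure_iidLaw_ge_le (ν := ν) hk
    (measurable_empRademacher (k := k) hc hm) ht
  have hmean := integral_deviationSup_le (ν := ν) hk hc hm hB₀ hB
  rw [two_mul (B ^ 2 / t ^ 2), ENNReal.ofReal_add (by positivity) (by positivity)]
  refine (measure_mono fun s hs => ?_).trans
    ((measure_union_le _ _).trans (add_le_add hdev hrad))
  by_contra hns
  simp only [Set.mem_union, Set.mem_ofPred_eq, not_or, not_le] at hns hs
  linarith [(abs_lt.mp hns.1).2, (abs_lt.mp hns.2).1]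

lemma isRepresentative_of_deviationSup_le (hB₀ : 0 ≤ B) (hB : ∀ h ∈ D, ∀ x, |h x| ≤ B)
    {s : Fin k → S} (hs : deviationSup ν D s ≤ 2 * empRademacher D s + 3 * (t / √k))
    (hs_neg : deviationSup ν ((fun g => -g) '' D) s ≤ 2 * empRademacher D s + 3 * (t / √k)) :
    IsRepresentative ν D t s := by
  refine ⟨empRademacher_nonneg hB₀ fun h hh i => hB h hh _, fun h hh => ?_⟩
  have hB_neg : ∀ h ∈ (fun g : S → ℝ => -g) '' D, ∀ x, |h x| ≤ B := by
    rintro _ ⟨g, hg, rfl⟩ x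
    simpa using hB g hg x
  have hle := deviation_le_deviationSup (ν := ν) hB₀ hB hh s
  have hle_neg := deviation_le_deviationSup (ν := ν) hB₀ hB_neg (Set.mem_image_of_mem _ hh) s
  simp only [Pi.neg_apply, integral_neg, Finset.sum_neg_distrib] at hle_neg
  exact abs_le.mpr ⟨by linarith, hle.trans hs⟩

theorem measure_not_isRepresentative_le_of_countable (hk : 0 < k) (hc : D.Countable)
    (hm : ∀ h ∈ D, Measurable h) (hB₀ : 0 ≤ B) (hB : ∀ h ∈ D, ∀ x, |h x| ≤ B) (ht : 0 < t) :
    iidLaw ν k {s | ¬ IsRepresentative ν D t s} ≤ ENNReal.ofReal (4 * (B ^ 2 / t ^ 2)) := by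
  have hpos := measure_deviationSup_gt_le (ν := ν) hk hc hm hB₀ hB ht
  have hneg := measure_deviationSup_gt_le (ν := ν) (D := (fun g => -g) '' D) hk (hc.image _)
    (Set.forall_mem_image.mpr fun g hg => (hm g hg).neg) hB₀
    (Set.forall_mem_image.mpr fun g hg x => by simpa using hB g hg x) ht
  simp only [empRademacher_neg_image] at hneg
  rw [show 4 * (B ^ 2 / t ^ 2) = 2 * (B ^ 2 / t ^ 2) + 2 * (B ^ 2 / t ^ 2) by ring,
    ENNReal.ofReal_add (by positivity) (by positivity)]
  refine (measure_mono fun s hs => ?_).trans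
    ((measure_union_le _ _).trans (add_le_add hpos hneg))
  by_contra hns
  simp only [Set.mem_union, Set.mem_ofPred_eq, not_or, not_lt] at hns
  exact hs (isRepresentative_of_deviationSup_le hB₀ hB hns.1 hns.2)

lemma IsRepresentative.of_indicator_image {T : Set S} (hT : MeasurableSet T)
    (hTν : ∀ᵐ x ∂ν, x ∈ T) (hm : ∀ h ∈ D, Measurable h) (hDH : D ⊆ H)
    (hdense : ∀ h ∈ H, ∃ r : ℕ → S → ℝ, (∀ j, r j ∈ D) ∧
      ∀ x, Tendsto (fun j => r j x) atTop (𝓝 (h x)))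
    (hB₀ : 0 ≤ B) (hB : ∀ h ∈ H, ∀ x ∈ T, |h x| ≤ B) {s : Fin k → S} (hsT : ∀ i, s i ∈ T)
    (hs : IsRepresentative ν (T.indicator '' D) t s) : IsRepresentative ν H t s := by
  refine ⟨empRademacher_nonneg hB₀ fun h hh i => hB h hh _ (hsT i), fun h hh => ?_⟩
  obtain ⟨r, hrD, hr⟩ := hdense h hh
  have hbound : ∀ j x, ‖T.indicator (r j) x‖ ≤ B := fun j x => by
    rw [norm_indicator_eq_indicator_norm]
    exact Set.indicator_apply_le' (hB _ (hDH (hrD j)) x) fun _ => hB₀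
  have hmean : Tendsto (fun j => ∫ x, T.indicator (r j) x ∂ν) atTop (𝓝 (∫ x, h x ∂ν)) := by
    refine tendsto_integral_of_dominated_convergence (fun _ => B)
      (fun j => ((hm _ (hrD j)).indicator hT).aestronglyMeasurable) (integrable_const _)
      (fun j => ae_of_all _ (hbound j)) ?_
    filter_upwards [hTν] with x hx
    simpa only [Set.indicator_of_mem hx] using hr x
  have hsample : Tendsto (fun j => (k : ℝ)⁻¹ * ∑ i, T.indicator (r j) (s i)) atTop
      (𝓝 ((k : ℝ)⁻¹ * ∑ i, h (s i))) := by
    simp only [Set.indicator_of_mem (hsT _)]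
    exact (tendsto_finsetSum _ fun i _ => hr (s i)).const_mul _
  refine le_of_tendsto (hmean.sub hsample).abs (Eventually.of_forall fun j => ?_)
  refine (hs.2 _ (Set.mem_image_of_mem _ (hrD j))).trans ?_
  gcongr
  exact empRademacher_indicator_image_le hsT hDH hB₀ hB

theorem measure_not_isRepresentative_le (hk : 0 < k) (hH : IsSeparableClass H) {T : Set S}
    (hT : MeasurableSet T) (hTν : ∀ᵐ x ∂ν, x ∈ T) (hB₀ : 0 ≤ B)
    (hB : ∀ h ∈ H, ∀ x ∈ T, |h x| ≤ B) (ht : 0 < t) :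
    iidLaw ν k {s | ¬ IsRepresentative ν H t s} ≤ ENNReal.ofReal (4 * (B ^ 2 / t ^ 2)) := by
  obtain ⟨D, hDH, hc, hm, hdense⟩ := hH
  have hsT : ∀ᵐ s ∂iidLaw ν k, ∀ i, s i ∈ T := ae_all_iff.mpr fun i =>
    (measurePreserving_eval (fun _ : Fin k => ν) i).quasiMeasurePreserving.ae hTν
  refine (measure_mono_ae ?_).trans (measure_not_isRepresentative_le_of_countable
    (D := T.indicator '' D) hk (hc.image _)
    (Set.forall_mem_image.mpr fun g hg => (hm g hg).indicator hT) hB₀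
    (Set.forall_mem_image.mpr fun g hg x => ?_) ht)
  · filter_upwards [hsT] with s hsT hs hs'
    exact hs (.of_indicator_image hT hTν hm hDH hdense hB₀ hB hsT hs')
  · rw [← Real.norm_eq_abs, norm_indicator_eq_indicator_norm]
    exact Set.indicator_apply_le' (hB _ (hDH hg) x) fun _ => hB₀

end UniformDeviation

section ConditionalDistribution

variable {Ω α β γ : Type*} [MeasurableSpace Ω] [MeasurableSpace α] [MeasurableSpace β]
  [MeasurableSpace γ]

lemma measurePreserving_compProd_prodMkLeft {μ : Measure α} {ν : Measure β} {κ : Kernel β γ}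
    [SFinite μ] [SFinite ν] [IsSFiniteKernel κ] :
    MeasurePreserving (fun x : (α × β) × γ => (x.1.1, x.2))
      ((μ.prod ν) ⊗ₘ κ.prodMkLeft α) (μ.prod (κ ∘ₘ ν)) := by
  have hproj : Measurable fun x : (α × β) × γ => (x.1.1, x.2) := by fun_prop
  refine ⟨hproj, Measure.ext_of_lintegral _ fun f hf => ?_⟩
  have hlift : Measurable fun x : (α × β) × γ => f (x.1.1, x.2) := hf.comp hproj
  have hinner : Measurable fun x : α × β => ∫⁻ c, f (x.1, c) ∂κ x.2 :=
    Measurable.lintegral_kernel_prod_right' (κ := κ.prodMkLeft α) hlift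
  rw [lintegral_map hf hproj, Measure.lintegral_compProd hlift,
    lintegral_prod _ hf.aemeasurable]
  simp only [Kernel.prodMkLeft_apply]
  rw [lintegral_prod _ hinner.aemeasurable]
  refine lintegral_congr fun a => ?_
  exact (Measure.lintegral_bind κ.aemeasurable
    (hf.comp measurable_prodMk_left).aemeasurable).symm

variable [StandardBorelSpace β] [Nonempty β] {μ : Measure Ω} [IsProbabilityMeasure μ]
  {X : Ω → α} {Y : Ω → β} {Z : Ω → γ}

lemma integral_integral_condDistrib (hX : Measurable X) (hY : Measurable Y) {f : β → ℝ}
    (hf : Integrable f (μ.map Y)) :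
    ∫ x, ∫ y, f y ∂condDistrib Y X μ x ∂(μ.map X) = ∫ y, f y ∂(μ.map Y) := by
  have hXY : Measurable fun ω => (X ω, Y ω) := hX.prodMk hY
  have hsnd : (μ.map fun ω => (X ω, Y ω)).map Prod.snd = μ.map Y :=
    Measure.map_map measurable_snd hXY
  rw [← hsnd] at hf ⊢
  rw [integral_map measurable_snd.aemeasurable hf.1]
  rw [← compProd_map_condDistrib hY.aemeasurable] at hf ⊢
  exact (Measure.integral_compProd (hf.comp_measurable measurable_snd)).symm

lemma integral_condDistrib_ae_eq_condExp_of_condIndepFun [StandardBorelSpace Ω]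
    [StandardBorelSpace γ] (hX : Measurable X) (hY : Measurable Y) (hZ : Measurable Z)
    (hYZ : CondIndepFun (MeasurableSpace.comap X inferInstance) hX.comap_le Y Z μ)
    {f : (α × γ) × β → ℝ} (hf : StronglyMeasurable f)
    (hint : Integrable (fun ω => f ((X ω, Z ω), Y ω)) μ) :
    (fun ω => ∫ y, f ((X ω, Z ω), y) ∂condDistrib Y X μ (X ω)) =ᵐ[μ]
      μ[fun ω => f ((X ω, Z ω), Y ω) |
        MeasurableSpace.comap (fun ω => (X ω, Z ω)) inferInstance] := by
  have : Nonempty γ := (nonempty_of_isProbabilityMeasure μ).map Z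
  have hXZ : Measurable fun ω => (X ω, Z ω) := hX.prodMk hZ
  have hcond := ae_of_ae_map hXZ.aemeasurable
    ((condIndepFun_iff_condDistrib_prod_ae_eq_prodMkRight hY hZ hX).mp hYZ.symm)
  filter_upwards [condExp_prod_ae_eq_integral_condDistrib hXZ hY.aemeasurable hf hint, hcond]
    with ω hexp hdistrib
  rw [hexp, hdistrib, Kernel.prodMkRight_apply]

end ConditionalDistribution

namespace Population

variable {Ω 𝒰 𝒜 𝒵 𝒲 : Type*} [MeasurableSpace Ω] [MeasurableSpace 𝒰]
    [MeasurableSpace 𝒜] [MeasurableSpace 𝒵] [MeasurableSpace 𝒲] (P : Population Ω 𝒰 𝒜 𝒵 𝒲)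

instance : IsProbabilityMeasure P.lawA := Measure.isProbabilityMeasure_map P.measA.aemeasurable
instance : IsProbabilityMeasure P.lawU := Measure.isProbabilityMeasure_map P.measU.aemeasurable
instance : IsProbabilityMeasure P.lawW := Measure.isProbabilityMeasure_map P.measW.aemeasurable
instance : IsProbabilityMeasure P.lawWAZ :=
  Measure.isProbabilityMeasure_map (P.measW.prodMk (P.measA.prodMk P.measZ)).aemeasurable
instance : IsProbabilityMeasure P.lawYAZ :=
  Measure.isProbabilityMeasure_map (P.measY.prodMk (P.measA.prodMk P.measZ)).aemeasurable

/-- A version of `(a, u) ↦ E[Y | A = a, U = u]`. -/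
noncomputable def outcomeRegression (x : 𝒜 × 𝒰) : ℝ :=
  ∫ y, y ∂condDistrib P.Y (fun ω => (P.A ω, P.U ω)) P.μ x

/-- A version of `(a, u) ↦ E[h(a, W) | U = u]`. -/
noncomputable def bridgeRegression [StandardBorelSpace 𝒲] [Nonempty 𝒲] (h : 𝒜 → 𝒲 → ℝ)
    (x : 𝒜 × 𝒰) : ℝ :=
  ∫ w, h x.1 w ∂condDistrib P.W P.U P.μ x.2

variable {P} {h : 𝒜 → 𝒲 → ℝ} {M η : ℝ}

lemma condAZ_eq_of_ae_eq_condExp {χ : Type*} [MeasurableSpace χ] {X : Ω → χ} (hX : Measurable X)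
    {π : χ → 𝒜 × 𝒵} (hπ : Measurable π) (hAZ : (fun ω => (P.A ω, P.Z ω)) = π ∘ X)
    {f g : Ω → ℝ} (hfg : f =ᵐ[P.μ] P.μ[g | MeasurableSpace.comap X inferInstance]) :
    P.condAZ f =ᵐ[P.μ] P.condAZ g := by
  refine (condExp_congr_ae hfg).trans (condExp_condExp_of_le ?_ hX.comap_le)
  rw [hAZ, ← MeasurableSpace.comap_comp]
  exact MeasurableSpace.comap_mono hπ.comap_le

lemma integrable_outcome (hY : ∀ᵐ ω ∂P.μ, |P.Y ω| ≤ M) : Integrable P.Y P.μ :=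
  .of_bound P.measY.aestronglyMeasurable M hY

lemma measurable_outcomeRegression : Measurable P.outcomeRegression :=
  (StronglyMeasurable.integral_kernel stronglyMeasurable_id).measurable

lemma condAZ_outcomeRegression [StandardBorelSpace Ω] [StandardBorelSpace 𝒵]
    (hS : P.Structural) (hY : Integrable P.Y P.μ) :
    P.condAZ (fun ω => P.outcomeRegression (P.A ω, P.U ω)) =ᵐ[P.μ] P.condAZ P.Y := by
  have hAU := P.measA.prodMk P.measU
  exact condAZ_eq_of_ae_eq_condExp (hAU.prodMk P.measZ)
    (π := fun x : (𝒜 × 𝒰) × 𝒵 => (x.1.1, x.2)) (by fun_prop) rfl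
    (integral_condDistrib_ae_eq_condExp_of_condIndepFun hAU P.measY P.measZ hS.1
      (f := fun x => x.2) measurable_snd.stronglyMeasurable hY)

lemma ae_abs_outcomeRegression_le (hY : ∀ᵐ ω ∂P.μ, |P.Y ω| ≤ M) :
    ∀ᵐ ω ∂P.μ, |P.outcomeRegression (P.A ω, P.U ω)| ≤ M := by
  filter_upwards [ae_bdd_abs_condExp_of_ae_bdd_abs hY, condExp_ae_eq_integral_condDistrib'
    (P.measA.prodMk P.measU) (integrable_outcome hY)] with ω hbound heq
  rwa [heq] at hbound

lemma measurable_bridgeRegression [StandardBorelSpace 𝒲] [Nonempty 𝒲]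
    (hh : Measurable (fun x : 𝒜 × 𝒲 => h x.1 x.2)) : Measurable (P.bridgeRegression h) := by
  have hlift : StronglyMeasurable
      (Function.uncurry fun (x : 𝒜 × 𝒰) (w : 𝒲) => h x.1 w) :=
    (hh.comp (g := fun x : 𝒜 × 𝒲 => h x.1 x.2)
      (f := fun y : (𝒜 × 𝒰) × 𝒲 => (y.1.1, y.2)) (by fun_prop)).stronglyMeasurable
  exact (hlift.integral_kernel_prod_right
    (κ := (condDistrib P.W P.U P.μ).prodMkLeft 𝒜)).measurable

section BridgeGivenConfounder

variable [StandardBorelSpace Ω] [StandardBorelSpace 𝒜] [StandardBorelSpace 𝒵]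
  [StandardBorelSpace 𝒲] [Nonempty 𝒲]

lemma bridgeRegression_ae_eq_condExp (hS : P.Structural)
    (hh : Measurable (fun x : 𝒜 × 𝒲 => h x.1 x.2))
    (hint : Integrable (fun ω => h (P.A ω) (P.W ω)) P.μ) :
    (fun ω => P.bridgeRegression h (P.A ω, P.U ω)) =ᵐ[P.μ]
      P.μ[fun ω => h (P.A ω) (P.W ω) |
        MeasurableSpace.comap (fun ω => (P.U ω, (P.A ω, P.Z ω))) inferInstance] :=
  integral_condDistrib_ae_eq_condExp_of_condIndepFun P.measU P.measW (P.measA.prodMk P.measZ)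
    hS.2 (f := fun x : (𝒰 × (𝒜 × 𝒵)) × 𝒲 => h x.1.2.1 x.2)
    (hh.comp (f := fun x : (𝒰 × (𝒜 × 𝒵)) × 𝒲 => (x.1.2.1, x.2)) (by fun_prop)).stronglyMeasurable
    hint

lemma condAZ_bridgeRegression (hS : P.Structural)
    (hh : Measurable (fun x : 𝒜 × 𝒲 => h x.1 x.2))
    (hint : Integrable (fun ω => h (P.A ω) (P.W ω)) P.μ) :
    P.condAZ (fun ω => P.bridgeRegression h (P.A ω, P.U ω)) =ᵐ[P.μ]
      P.condAZ (fun ω => h (P.A ω) (P.W ω)) :=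
  condAZ_eq_of_ae_eq_condExp (P.measU.prodMk (P.measA.prodMk P.measZ)) measurable_snd rfl
    (bridgeRegression_ae_eq_condExp hS hh hint)

lemma memLp_two_bridgeRegression (hS : P.Structural)
    (hh : Measurable (fun x : 𝒜 × 𝒲 => h x.1 x.2))
    (hL : MemLp (fun ω => h (P.A ω) (P.W ω)) 2 P.μ) :
    MemLp (fun ω => P.bridgeRegression h (P.A ω, P.U ω)) 2 P.μ :=
  (hL.condExp one_le_two).ae_eq
    (bridgeRegression_ae_eq_condExp hS hh (hL.integrable one_le_two)).symm

end BridgeGivenConfounder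

section BridgeMarginal

variable [StandardBorelSpace 𝒲] [Nonempty 𝒲]

lemma memLp_two_bridgeRegression_prod
    (hL : MemLp (fun x : 𝒜 × 𝒲 => h x.1 x.2) 2 (P.lawA.prod P.lawW)) :
    MemLp (P.bridgeRegression h) 2 (P.lawA.prod P.lawU) := by
  have hlaw : condDistrib P.W P.U P.μ ∘ₘ P.lawU = P.lawW :=
    condDistrib_comp_map P.measU.aemeasurable P.measW.aemeasurable
  rw [← hlaw] at hL
  exact memLp_two_integral_kernel (hL.comp_measurePreserving measurePreserving_compProd_prodMkLeft)

lemma integral_bridgeRegression {a : 𝒜} (hint : Integrable (h a) P.lawW) :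
    ∫ u, P.bridgeRegression h (a, u) ∂P.lawU = ∫ w, h a w ∂P.lawW :=
  integral_integral_condDistrib P.measU P.measW hint

end BridgeMarginal

lemma GoodSupport.memLp_two (hη : P.GoodSupport η) {f : 𝒜 × 𝒲 → ℝ} (hf : Measurable f)
    (hL : MemLp (fun ω => f (P.A ω, P.W ω)) 2 P.μ) : MemLp f 2 (P.lawA.prod P.lawW) :=
  ((memLp_map_measure_iff hf.aestronglyMeasurable
    (P.measA.prodMk P.measW).aemeasurable).mpr hL).of_measure_le_smul ENNReal.ofReal_ne_top hη

-- Completeness is applied to the indicator of a null set of the joint law.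
lemma CompleteFor.absolutelyContinuous {χ : Type*} [MeasurableSpace χ] {X : Ω → χ}
    (hX : Measurable X) (hc : P.CompleteFor X) :
    P.lawA.prod (P.μ.map X) ≪ P.μ.map (fun ω => (P.A ω, X ω)) := by
  have : IsProbabilityMeasure (P.μ.map X) := Measure.isProbabilityMeasure_map hX.aemeasurable
  have hAX := P.measA.prodMk hX
  refine Measure.AbsolutelyContinuous.mk fun N hN hN₀ => ?_
  rw [Measure.map_apply hAX hN] at hN₀
  have hL : ∀ (ρ : Measure (𝒜 × χ)) [IsProbabilityMeasure ρ],
      MemLp (N.indicator fun _ => (1 : ℝ)) 2 ρ := fun ρ _ => (memLp_const 1).indicator hN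
  have : IsProbabilityMeasure (P.μ.map fun ω => (P.A ω, X ω)) :=
    Measure.isProbabilityMeasure_map hAX.aemeasurable
  have hzero : (fun ω => N.indicator (fun _ => (1 : ℝ)) (P.A ω, X ω)) =ᵐ[P.μ] 0 := by
    filter_upwards [measure_eq_zero_iff_ae_notMem.mp hN₀] with ω hω
    simpa using hω
  have hcond : P.condAZ (fun ω => N.indicator (fun _ => (1 : ℝ)) (P.A ω, X ω)) =ᵐ[P.μ] 0 :=
    (condExp_congr_ae hzero).trans (by rw [condExp_zero])
  rw [measure_eq_zero_iff_ae_notMem]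
  filter_upwards [hc _ (measurable_const.indicator hN) (hL _)
    ((hL _).comp_of_map hAX.aemeasurable) hcond] with x hx hxN
  simp [hxN] at hx

lemma memLp_two_outcomeRegression_prod (hU : P.CompleteFor P.U) (hY : ∀ᵐ ω ∂P.μ, |P.Y ω| ≤ M) :
    MemLp P.outcomeRegression 2 (P.lawA.prod P.lawU) := by
  refine .of_bound measurable_outcomeRegression.aestronglyMeasurable M
    ((hU.absolutelyContinuous P.measU).ae_le ?_)
  exact (ae_map_iff (P.measA.prodMk P.measU).aemeasurable
    (measurableSet_le measurable_outcomeRegression.norm measurable_const)).mpr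
    (ae_abs_outcomeRegression_le hY)

variable [StandardBorelSpace Ω] [StandardBorelSpace 𝒜] [StandardBorelSpace 𝒵]
  [StandardBorelSpace 𝒲]

theorem IsBridge.outcomeRegression_ae_eq [Nonempty 𝒲] (hh : P.IsBridge h) (hS : P.Structural)
    (hU : P.CompleteFor P.U) (hY : ∀ᵐ ω ∂P.μ, |P.Y ω| ≤ M) (hη : P.GoodSupport η) :
    P.outcomeRegression =ᵐ[P.lawA.prod P.lawU] P.bridgeRegression h := by
  have he := measurable_outcomeRegression (P := P)
  have hg := measurable_bridgeRegression (P := P) hh.measurable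
  have he2 : MemLp (fun ω => P.outcomeRegression (P.A ω, P.U ω)) 2 P.μ :=
    .of_bound (he.comp (P.measA.prodMk P.measU)).aestronglyMeasurable M
      (ae_abs_outcomeRegression_le hY)
  have hg2 := memLp_two_bridgeRegression hS hh.measurable hh.memLp
  have hcond : P.condAZ (fun ω => (P.outcomeRegression - P.bridgeRegression h) (P.A ω, P.U ω))
      =ᵐ[P.μ] 0 := by
    filter_upwards [condExp_sub (he2.integrable one_le_two) (hg2.integrable one_le_two) _,
      condAZ_outcomeRegression hS (integrable_outcome hY),
      condAZ_bridgeRegression hS hh.measurable (hh.memLp.integrable one_le_two), hh.bridge]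
      with ω hsub hout hbr heq
    exact hsub.trans (sub_eq_zero.mpr (hout.trans (heq.trans hbr.symm)))
  have hzero := hU _ (he.sub hg) ((memLp_two_outcomeRegression_prod hU hY).sub
    (memLp_two_bridgeRegression_prod (hη.memLp_two hh.measurable hh.memLp))) (he2.sub hg2) hcond
  filter_upwards [hzero] with x hx using sub_eq_zero.mp hx

theorem IsBridge.fStruct_ae_eq (hh : P.IsBridge h) (hS : P.Structural)
    (hU : P.CompleteFor P.U) (hY : ∀ᵐ ω ∂P.μ, |P.Y ω| ≤ M) (hη : P.GoodSupport η) :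
    ∀ᵐ a ∂P.lawA, P.fStruct a = ∫ w, h a w ∂P.lawW := by
  have : Nonempty 𝒲 := (nonempty_of_isProbabilityMeasure P.μ).map P.W
  have hint := (hη.memLp_two hh.measurable hh.memLp).integrable one_le_two
  filter_upwards [Measure.ae_ae_of_ae_prod (hh.outcomeRegression_ae_eq hS hU hY hη),
    hint.prod_right_ae] with a ha hinta
  exact (integral_congr_ae ha).trans (integral_bridgeRegression hinta)

end Population

section L2

variable {X : Type*} {mX : MeasurableSpace X} {μ : Measure X}

lemma eLpNorm_two_eq_ofReal_sqrt {f : X → ℝ} (hf : MemLp f 2 μ) :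
    eLpNorm f 2 μ = ENNReal.ofReal √(∫ x, f x ^ 2 ∂μ) := by
  rw [hf.eLpNorm_eq_integral_rpow_norm two_ne_zero ENNReal.ofNat_ne_top]
  simp [Real.sqrt_eq_rpow]

/-- The distance of `f` and `g` in `L²(μ)`, for real functions that are square integrable. -/
noncomputable def l2Dist (μ : Measure X) (f g : X → ℝ) : ℝ := √(∫ x, (f x - g x) ^ 2 ∂μ)

lemma l2Dist_nonneg (f g : X → ℝ) : 0 ≤ l2Dist μ f g := Real.sqrt_nonneg _

lemma l2Dist_comm (f g : X → ℝ) : l2Dist μ f g = l2Dist μ g f := by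
  simp only [l2Dist, sub_sq_comm]

lemma sq_l2Dist (f g : X → ℝ) : l2Dist μ f g ^ 2 = ∫ x, (f x - g x) ^ 2 ∂μ :=
  Real.sq_sqrt (integral_nonneg fun _ => sq_nonneg _)

lemma eLpNorm_sub_eq_ofReal_l2Dist {f g : X → ℝ} (hf : MemLp f 2 μ) (hg : MemLp g 2 μ) :
    eLpNorm (f - g) 2 μ = ENNReal.ofReal (l2Dist μ f g) :=
  eLpNorm_two_eq_ofReal_sqrt (hf.sub hg)

lemma l2Dist_triangle {f g h : X → ℝ} (hf : MemLp f 2 μ) (hg : MemLp g 2 μ) (hh : MemLp h 2 μ) :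
    l2Dist μ f h ≤ l2Dist μ f g + l2Dist μ g h := by
  have htri := eLpNorm_add_le (hf.sub hg).1 (hg.sub hh).1 one_le_two
  rw [sub_add_sub_cancel, eLpNorm_sub_eq_ofReal_l2Dist hf hg, eLpNorm_sub_eq_ofReal_l2Dist hg hh,
    eLpNorm_sub_eq_ofReal_l2Dist hf hh,
    ← ENNReal.ofReal_add (l2Dist_nonneg _ _) (l2Dist_nonneg _ _)] at htri
  exact (ENNReal.ofReal_le_ofReal_iff (add_nonneg (l2Dist_nonneg _ _) (l2Dist_nonneg _ _))).1 htri

lemma integral_sub_condExp_mul_eq_zero [IsFiniteMeasure μ] {m : MeasurableSpace X} (hm : m ≤ mX)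
    {f g : X → ℝ} (hf : MemLp f 2 μ) (hg : MemLp g 2 μ) (hgm : StronglyMeasurable[m] g) :
    ∫ x, (f x - (μ[f | m]) x) * g x ∂μ = 0 := by
  have hfg : Integrable (f * g) μ := hf.integrable_mul hg
  have hEg : Integrable (μ[f | m] * g) μ := (hf.condExp one_le_two).integrable_mul hg
  have hpull : ∫ x, (μ[f | m] * g) x ∂μ = ∫ x, (f * g) x ∂μ := by
    rw [← integral_condExp hm (f := f * g)]
    exact integral_congr_ae
      (condExp_mul_of_stronglyMeasurable_right hgm hfg (hf.integrable one_le_two)).symm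
  simp only [sub_mul]
  exact (integral_sub hfg hEg).trans (sub_eq_zero.2 hpull.symm)

lemma integral_sub_sq_eq_add_condExp [IsFiniteMeasure μ] {m : MeasurableSpace X} (hm : m ≤ mX)
    {f g : X → ℝ} (hf : MemLp f 2 μ) (hg : MemLp g 2 μ) (hgm : StronglyMeasurable[m] g) :
    ∫ x, (f x - g x) ^ 2 ∂μ
      = ∫ x, (f x - (μ[f | m]) x) ^ 2 ∂μ + ∫ x, ((μ[f | m]) x - g x) ^ 2 ∂μ := by
  have hE : MemLp (μ[f | m]) 2 μ := hf.condExp one_le_two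
  have horth := integral_sub_condExp_mul_eq_zero hm hf (hE.sub hg)
    (stronglyMeasurable_condExp.sub hgm)
  have hcross : Integrable (fun x => (f x - (μ[f | m]) x) * ((μ[f | m]) x - g x)) μ :=
    (hf.sub hE).integrable_mul (hE.sub hg)
  have hsq₁ : Integrable (fun x => (f x - (μ[f | m]) x) ^ 2) μ := (hf.sub hE).integrable_sq
  have hsq₂ : Integrable (fun x => ((μ[f | m]) x - g x) ^ 2) μ := (hE.sub hg).integrable_sq
  calc ∫ x, (f x - g x) ^ 2 ∂μ
      = ∫ x, ((f x - (μ[f | m]) x) ^ 2 + ((μ[f | m]) x - g x) ^ 2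
          + 2 * ((f x - (μ[f | m]) x) * ((μ[f | m]) x - g x))) ∂μ := by
        congr 1 with x
        ring
    _ = _ := by
        rw [integral_add (by exact hsq₁.add hsq₂) (hcross.const_mul 2), integral_add hsq₁ hsq₂,
          integral_const_mul]
        simpa using horth

end L2

section SqNorm

variable {ι : Type*} [Fintype ι]

@[fun_prop]
lemma continuous_sqNorm : Continuous (sqNorm : (ι → ℝ) → ℝ) := by
  unfold sqNorm
  fun_prop

lemma sqNorm_nonneg (x : ι → ℝ) : 0 ≤ sqNorm x := Finset.sum_nonneg fun _ _ => sq_nonneg _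

lemma sqNorm_smul (c : ℝ) (x : ι → ℝ) : sqNorm (c • x) = c ^ 2 * sqNorm x := by
  simp [sqNorm, mul_pow, Finset.mul_sum]

lemma sqNorm_eq_zero {x : ι → ℝ} : sqNorm x = 0 ↔ x = 0 := by
  simp [sqNorm, Finset.sum_eq_zero_iff_of_nonneg, sq_nonneg, funext_iff]

lemma sqNorm_sub_le (x y : ι → ℝ) : sqNorm (x - y) ≤ 2 * (sqNorm x + sqNorm y) := by
  simp only [sqNorm, ← Finset.sum_add_distrib, Finset.mul_sum, Pi.sub_apply]
  exact Finset.sum_le_sum fun i _ => by nlinarith [sq_nonneg (x i + y i)]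

lemma abs_apply_le_sqrt_sqNorm (x : ι → ℝ) (i : ι) : |x i| ≤ √(sqNorm x) :=
  Real.abs_le_sqrt
    (Finset.single_le_sum (f := fun i => x i ^ 2) (fun _ _ => sq_nonneg _) (Finset.mem_univ i))

end SqNorm

namespace Model

section Algebra

variable {𝒜 𝒵 𝒲 ΘA1 ΘZ ΘA2 ΘW : Type*} [MeasurableSpace 𝒜] [MeasurableSpace 𝒵]
    [MeasurableSpace 𝒲] {pA pZ qA d : ℕ} (F : Model 𝒜 𝒵 𝒲 ΘA1 ΘZ ΘA2 ΘW pA pZ qA d)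

/-- The vector `c` that represents the linear form of stage 2, `uᵀ (ψ_A(a) ⊗ v) = c ⬝ᵥ v`. -/
def lin2Coef (p : Param2 ΘA2 ΘW qA d) (a : 𝒜) (j : Fin d) : ℝ :=
  ∑ i, p.u (i, j) * F.ψA p.θA a i

lemma lin2_eq_dotProduct (p : Param2 ΘA2 ΘW qA d) (a : 𝒜) (v : Fin d → ℝ) :
    F.lin2 p a v = F.lin2Coef p a ⬝ᵥ v := by
  simp only [lin2, dotProduct, kron, Fintype.sum_prod_type_right, lin2Coef, Finset.sum_mul,
    mul_assoc]

lemma lin2_single (p : Param2 ΘA2 ΘW qA d) (a : 𝒜) (j : Fin d) :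
    F.lin2 p a (Pi.single j 1) = F.lin2Coef p a j := by
  rw [lin2_eq_dotProduct, dotProduct_single_one]

lemma lin2_zero (p : Param2 ΘA2 ΘW qA d) (a : 𝒜) : F.lin2 p a 0 = 0 := by
  rw [lin2_eq_dotProduct, dotProduct_zero]

lemma lin2_sub (p : Param2 ΘA2 ΘW qA d) (a : 𝒜) (v w : Fin d → ℝ) :
    F.lin2 p a (v - w) = F.lin2 p a v - F.lin2 p a w := by
  simp only [lin2_eq_dotProduct, dotProduct_sub]

lemma lin2_smul (p : Param2 ΘA2 ΘW qA d) (a : 𝒜) (c : ℝ) (v : Fin d → ℝ) :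
    F.lin2 p a (c • v) = c * F.lin2 p a v := by
  simp only [lin2_eq_dotProduct, dotProduct_smul, smul_eq_mul]

lemma fHat_eq (p : Param2 ΘA2 ΘW qA d) {k : ℕ} (w : Fin k → 𝒲) (a : 𝒜) :
    F.fHat p w a = (k : ℝ)⁻¹ * ∑ i, F.bridge p a (w i) := by
  simp only [fHat, bridge, lin2_eq_dotProduct, dotProduct_smul, dotProduct_sum, smul_eq_mul]

lemma tendsto_lin2 {r : ℕ → Param2 ΘA2 ΘW qA d} {p : Param2 ΘA2 ΘW qA d} {a : 𝒜}
    (hr : ∀ v, Tendsto (fun k => F.lin2 (r k) a v) atTop (𝓝 (F.lin2 p a v)))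
    {v : ℕ → Fin d → ℝ} {v₀ : Fin d → ℝ} (hv : Tendsto v atTop (𝓝 v₀)) :
    Tendsto (fun k => F.lin2 (r k) a (v k)) atTop (𝓝 (F.lin2 p a v₀)) := by
  have hcoef : Tendsto (fun k => F.lin2Coef (r k) a) atTop (𝓝 (F.lin2Coef p a)) :=
    tendsto_pi_nhds.2 fun j => by simpa only [lin2_single] using hr (Pi.single j 1)
  simp only [lin2_eq_dotProduct, dotProduct]
  exact tendsto_finsetSum _ fun j _ => (hcoef.apply_nhds j).mul (hv.apply_nhds j)

lemma measurable_lin2Coef (p : Param2 ΘA2 ΘW qA d) : Measurable (F.lin2Coef p) := by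
  have := F.meas_ψA p.θA
  unfold lin2Coef
  fun_prop

lemma measurable_lin2 {X : Type*} [MeasurableSpace X] (p : Param2 ΘA2 ΘW qA d) {a : X → 𝒜}
    {v : X → Fin d → ℝ} (ha : Measurable a) (hv : Measurable v) :
    Measurable fun x => F.lin2 p (a x) (v x) := by
  have := F.measurable_lin2Coef p
  simp only [lin2_eq_dotProduct, dotProduct]
  fun_prop

lemma measurable_pred1 (q : Param1 ΘA1 ΘZ pA pZ d) :
    Measurable fun x : 𝒜 × 𝒵 => F.pred1 q x.1 x.2 := by
  have := F.meas_φA q.θA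
  have := F.meas_φZ q.θZ
  refine measurable_pi_iff.2 fun i => ?_
  simp only [pred1, Matrix.mulVec, dotProduct, kron]
  fun_prop

lemma measurable_lin2_pred1 (p : Param2 ΘA2 ΘW qA d) (q : Param1 ΘA1 ΘZ pA pZ d) :
    Measurable fun x : 𝒜 × 𝒵 => F.lin2 p x.1 (F.pred1 q x.1 x.2) :=
  F.measurable_lin2 p measurable_fst (F.measurable_pred1 q)

lemma measurable_bridge (p : Param2 ΘA2 ΘW qA d) :
    Measurable fun x : 𝒜 × 𝒲 => F.bridge p x.1 x.2 :=
  F.measurable_lin2 p measurable_fst ((F.meas_ψW p.θW).comp measurable_snd)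

lemma measurable_loss1 (θ : ΘW) (q : Param1 ΘA1 ΘZ pA pZ d) : Measurable (F.loss1 θ q) :=
  continuous_sqNorm.measurable.comp
    (((F.meas_ψW θ).comp measurable_fst).sub ((F.measurable_pred1 q).comp measurable_snd))

lemma measurable_loss2 (p : Param2 ΘA2 ΘW qA d) (q : Param1 ΘA1 ΘZ pA pZ d) :
    Measurable (F.loss2 p q) :=
  (measurable_fst.sub ((F.measurable_lin2_pred1 p q).comp measurable_snd)).pow_const 2

lemma class1_eq_image :
    F.class1 = (fun x : Param2 ΘA2 ΘW qA d × _ => F.loss1 x.1.θW x.2) '' (F.adm2 ×ˢ F.adm1) := by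
  ext f
  simp [class1, eq_comm, and_assoc]

lemma class2_eq_image :
    F.class2 = (fun x : Param2 ΘA2 ΘW qA d × _ => F.loss2 x.1 x.2) '' (F.adm2 ×ˢ F.adm1) := by
  ext f
  simp [class2, eq_comm]

variable {F}

lemma PointwiseSeparable.isSeparableClass_class1 (hF : F.PointwiseSeparable) :
    IsSeparableClass F.class1 := by
  obtain ⟨⟨D₁, hD₁, hc₁, hd₁⟩, D₂, hD₂, hc₂, hd₂⟩ := hF
  rw [class1_eq_image]
  refine isSeparableClass_image (Set.prod_mono hD₂ hD₁) (hc₂.prod hc₁)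
    (fun _ _ => F.measurable_loss1 _ _) fun ⟨p, q⟩ ⟨hp, hq⟩ => ?_
  obtain ⟨r₁, hr₁, hl₁⟩ := hd₁ q hq
  obtain ⟨r₂, hr₂, hl₂, -⟩ := hd₂ p hp
  exact ⟨fun j => (r₂ j, r₁ j), fun j => ⟨hr₂ j, hr₁ j⟩,
    fun x => (continuous_sqNorm.tendsto _).comp ((hl₂ x.1).sub (hl₁ x.2.1 x.2.2))⟩

lemma PointwiseSeparable.isSeparableClass_class2 (hF : F.PointwiseSeparable) :
    IsSeparableClass F.class2 := by
  obtain ⟨⟨D₁, hD₁, hc₁, hd₁⟩, D₂, hD₂, hc₂, hd₂⟩ := hF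
  rw [class2_eq_image]
  refine isSeparableClass_image (Set.prod_mono hD₂ hD₁) (hc₂.prod hc₁)
    (fun _ _ => F.measurable_loss2 _ _) fun ⟨p, q⟩ ⟨hp, hq⟩ => ?_
  obtain ⟨r₁, hr₁, hl₁⟩ := hd₁ q hq
  obtain ⟨r₂, hr₂, -, hl₂⟩ := hd₂ p hp
  exact ⟨fun j => (r₂ j, r₁ j), fun j => ⟨hr₂ j, hr₁ j⟩,
    fun x => ((F.tendsto_lin2 (hl₂ x.2.1) (hl₁ x.2.1 x.2.2)).const_sub x.1).pow 2⟩

end Algebra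

namespace BoundedBy

variable {Ω 𝒰 𝒜 𝒵 𝒲 ΘA1 ΘZ ΘA2 ΘW : Type*} [MeasurableSpace Ω] [MeasurableSpace 𝒰]
    [MeasurableSpace 𝒜] [MeasurableSpace 𝒵] [MeasurableSpace 𝒲] {pA pZ qA d : ℕ}
    {F : Model 𝒜 𝒵 𝒲 ΘA1 ΘZ ΘA2 ΘW pA pZ qA d} {P : Population Ω 𝒰 𝒜 𝒵 𝒲} {M : ℝ}
    {p : Param2 ΘA2 ΘW qA d} {q : Param1 ΘA1 ΘZ pA pZ d}

lemma nonneg (h : F.BoundedBy P M) : 0 ≤ M :=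
  let ⟨_, hω⟩ := h.outcome.exists
  (abs_nonneg _).trans hω

lemma sqNorm_pred1_le (h : F.BoundedBy P M) (hq : q ∈ F.adm1) (a : 𝒜) (z : 𝒵) :
    sqNorm (F.pred1 q a z) ≤ M ^ 2 :=
  (Real.sqrt_le_left h.nonneg).1 (h.stage1 q hq a z)

lemma sqNorm_ψW_le (h : F.BoundedBy P M) (hp : p ∈ F.adm2) (w : 𝒲) :
    sqNorm (F.ψW p.θW w) ≤ M ^ 2 :=
  (Real.sqrt_le_left h.nonneg).1 (h.feature p hp w)

lemma abs_lin2_le (h : F.BoundedBy P M) (hp : p ∈ F.adm2) (a : 𝒜) (v : Fin d → ℝ) :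
    |F.lin2 p a v| ≤ M * √(sqNorm v) := by
  rcases (sqNorm_nonneg v).eq_or_lt' with hv | hv
  · simp [sqNorm_eq_zero.1 hv, lin2_zero, sqNorm]
  · have hs : 0 < √(sqNorm v) := Real.sqrt_pos.2 hv
    have hunit : sqNorm ((√(sqNorm v))⁻¹ • v) = 1 := by
      rw [sqNorm_smul, inv_pow, Real.sq_sqrt hv.le, inv_mul_cancel₀ hv.ne']
    have hle := h.weight p hp a _ hunit.le
    rwa [lin2_smul, abs_mul, abs_of_pos (inv_pos.2 hs), inv_mul_le_iff₀ hs, mul_comm] at hle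

lemma lin2_sq_le (h : F.BoundedBy P M) (hp : p ∈ F.adm2) (a : 𝒜) (v : Fin d → ℝ) :
    F.lin2 p a v ^ 2 ≤ M ^ 2 * sqNorm v := by
  have hsq := pow_le_pow_left₀ (abs_nonneg _) (h.abs_lin2_le hp a v) 2
  rwa [sq_abs, mul_pow, Real.sq_sqrt (sqNorm_nonneg v)] at hsq

lemma abs_lin2_le_sq (h : F.BoundedBy P M) (hp : p ∈ F.adm2) (a : 𝒜) {v : Fin d → ℝ}
    (hv : √(sqNorm v) ≤ M) : |F.lin2 p a v| ≤ M ^ 2 := by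
  rw [pow_two]
  exact (h.abs_lin2_le hp a v).trans (mul_le_mul_of_nonneg_left hv h.nonneg)

lemma abs_bridge_le (h : F.BoundedBy P M) (hp : p ∈ F.adm2) (a : 𝒜) (w : 𝒲) :
    |F.bridge p a w| ≤ M ^ 2 :=
  h.abs_lin2_le_sq hp a (h.feature p hp w)

lemma abs_lin2_pred1_le (h : F.BoundedBy P M) (hp : p ∈ F.adm2) (hq : q ∈ F.adm1) (a : 𝒜)
    (z : 𝒵) : |F.lin2 p a (F.pred1 q a z)| ≤ M ^ 2 :=
  h.abs_lin2_le_sq hp a (h.stage1 q hq a z)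

lemma abs_lin2Coef_le (h : F.BoundedBy P M) (hp : p ∈ F.adm2) (a : 𝒜) (j : Fin d) :
    |F.lin2Coef p a j| ≤ M := by
  rw [← lin2_single]
  exact h.weight p hp a _ (by simp [sqNorm, Pi.single_apply])

lemma abs_le_of_mem_class1 (h : F.BoundedBy P M) {f : 𝒲 × 𝒜 × 𝒵 → ℝ} (hf : f ∈ F.class1)
    (x : 𝒲 × 𝒜 × 𝒵) : |f x| ≤ 4 * M ^ 2 := by
  obtain ⟨p, hp, q, hq, rfl⟩ := hf
  rw [loss1, abs_of_nonneg (sqNorm_nonneg _)]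
  linarith [sqNorm_sub_le (F.ψW p.θW x.1) (F.pred1 q x.2.1 x.2.2), h.sqNorm_ψW_le hp x.1,
    h.sqNorm_pred1_le hq x.2.1 x.2.2]

lemma abs_le_of_mem_class2 (h : F.BoundedBy P M) {f : ℝ × 𝒜 × 𝒵 → ℝ} (hf : f ∈ F.class2)
    {x : ℝ × 𝒜 × 𝒵} (hx : |x.1| ≤ M) : |f x| ≤ (M + M ^ 2) ^ 2 := by
  obtain ⟨p, hp, q, hq, rfl⟩ := hf
  rw [loss2, abs_pow]
  gcongr
  exact (abs_sub _ _).trans (add_le_add hx (h.abs_lin2_pred1_le hp hq x.2.1 x.2.2))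

lemma ae_abs_fst_le_lawYAZ (h : F.BoundedBy P M) : ∀ᵐ x ∂P.lawYAZ, |x.1| ≤ M := by
  have hm : Measurable fun ω => (P.Y ω, P.A ω, P.Z ω) := P.measY.prodMk (P.measA.prodMk P.measZ)
  exact (ae_map_iff hm.aemeasurable
    (measurableSet_le measurable_fst.abs measurable_const)).2 h.outcome

end BoundedBy

end Model

lemma sqrt_add_le_sqrt_add_sqrt (a b : ℝ) : √(a + b) ≤ √a + √b := by
  have hle (x : ℝ) : x ≤ √x ^ 2 := by
    rw [Real.sq_sqrt']
    exact le_max_left x 0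
  refine Real.sqrt_le_iff.2 ⟨by positivity, ?_⟩
  nlinarith [hle a, hle b, mul_nonneg (Real.sqrt_nonneg a) (Real.sqrt_nonneg b)]

lemma risk_le_of_penalized_empiricalRisk_le {R R' r r' π π' c Δ : ℝ}
    (hmin : r + π ≤ r' + π') (hπ : 0 ≤ π) (hπ' : π' ≤ c) (hr : |R - r| ≤ Δ)
    (hr' : |R' - r'| ≤ Δ) : R ≤ R' + (c + 2 * Δ) := by
  linarith [(abs_le.1 hr).2, (abs_le.1 hr').1]

namespace Population

variable {Ω 𝒰 𝒜 𝒵 𝒲 : Type*} [MeasurableSpace Ω] [MeasurableSpace 𝒰]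
    [MeasurableSpace 𝒜] [MeasurableSpace 𝒵] [MeasurableSpace 𝒲] {P : Population Ω 𝒰 𝒜 𝒵 𝒲}

lemma comap_AZ_le :
    MeasurableSpace.comap (fun ω => (P.A ω, P.Z ω)) inferInstance ≤ ‹MeasurableSpace Ω› :=
  (P.measA.prodMk P.measZ).comap_le

lemma stronglyMeasurable_comap_AZ {f : 𝒜 × 𝒵 → ℝ} (hf : Measurable f) :
    StronglyMeasurable[MeasurableSpace.comap (fun ω => (P.A ω, P.Z ω)) inferInstance]
      fun ω => f (P.A ω, P.Z ω) :=
  (hf.comp (comap_measurable fun ω => (P.A ω, P.Z ω))).stronglyMeasurable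

lemma integral_sub_sq_eq_add_condAZ {f : Ω → ℝ} {g : 𝒜 × 𝒵 → ℝ} (hf : MemLp f 2 P.μ)
    (hg : Measurable g) (hgL : MemLp (fun ω => g (P.A ω, P.Z ω)) 2 P.μ) :
    ∫ ω, (f ω - g (P.A ω, P.Z ω)) ^ 2 ∂P.μ
      = ∫ ω, (f ω - P.condAZ f ω) ^ 2 ∂P.μ
        + ∫ ω, (P.condAZ f ω - g (P.A ω, P.Z ω)) ^ 2 ∂P.μ :=
  integral_sub_sq_eq_add_condExp comap_AZ_le hf hgL (stronglyMeasurable_comap_AZ hg)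

lemma condAZ_sum_mul {ι : Type*} [Fintype ι] {c : ι → 𝒜 × 𝒵 → ℝ} {f : ι → Ω → ℝ} {B : ℝ}
    (hc : ∀ i, Measurable (c i)) (hB : ∀ i x, |c i x| ≤ B) (hf : ∀ i, Integrable (f i) P.μ) :
    P.condAZ (fun ω => ∑ i, c i (P.A ω, P.Z ω) * f i ω)
      =ᵐ[P.μ] fun ω => ∑ i, c i (P.A ω, P.Z ω) * P.condAZ (f i) ω := by
  have hmeas : ∀ i, Measurable fun ω => c i (P.A ω, P.Z ω) := fun i =>
    (hc i).comp (P.measA.prodMk P.measZ)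
  have hint : ∀ i ∈ Finset.univ, Integrable (fun ω => c i (P.A ω, P.Z ω) * f i ω) P.μ :=
    fun i _ => (hf i).bdd_mul (hmeas i).aestronglyMeasurable (ae_of_all _ fun ω => hB i _)
  have hpull : ∀ i, P.condAZ (fun ω => c i (P.A ω, P.Z ω) * f i ω)
      =ᵐ[P.μ] fun ω => c i (P.A ω, P.Z ω) * P.condAZ (f i) ω := fun i =>
    condExp_stronglyMeasurable_mul_of_bound comap_AZ_le (stronglyMeasurable_comap_AZ (hc i)) (hf i)
      B (ae_of_all _ fun ω => hB i _)
  have hsum := condExp_finsetSum hint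
    (MeasurableSpace.comap (fun ω => (P.A ω, P.Z ω)) inferInstance)
  rw [Finset.sum_fn] at hsum
  filter_upwards [hsum, ae_all_iff.2 hpull] with ω hω hω'
  rw [condAZ, hω, Finset.sum_apply]
  exact Finset.sum_congr rfl fun i _ => hω' i

end Population

namespace Model

variable {Ω 𝒰 𝒜 𝒵 𝒲 ΘA1 ΘZ ΘA2 ΘW : Type*} [MeasurableSpace Ω] [MeasurableSpace 𝒰]
    [MeasurableSpace 𝒜] [MeasurableSpace 𝒵] [MeasurableSpace 𝒲] {pA pZ qA d : ℕ}

section Risk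

variable (F : Model 𝒜 𝒵 𝒲 ΘA1 ΘZ ΘA2 ΘW pA pZ qA d) (P : Population Ω 𝒰 𝒜 𝒵 𝒲)

/-- The regression `E[ψ_W(W) | A, Z]` of the outcome features, the target of stage 1. -/
noncomputable def regress (θ : ΘW) (ω : Ω) (i : Fin d) : ℝ :=
  P.condAZ (fun ω' => F.ψW θ (P.W ω') i) ω

/-- The excess risk of stage 1, `E ‖E[ψ_W(W) | A, Z] - V (φ_A(A) ⊗ φ_Z(Z))‖²`. -/
noncomputable def excess1 (θ : ΘW) (q : Param1 ΘA1 ΘZ pA pZ d) : ℝ :=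
  ∫ ω, sqNorm (F.regress P θ ω - F.pred1 q (P.A ω) (P.Z ω)) ∂P.μ

/-- The regression `E[h(A, W) | A, Z]` of a bridge function of the model. -/
noncomputable def condBridge (p : Param2 ΘA2 ΘW qA d) : Ω → ℝ :=
  P.condAZ fun ω => F.bridge p (P.A ω) (P.W ω)

/-- The stage 2 prediction `uᵀ (ψ_A(A) ⊗ V (φ_A(A) ⊗ φ_Z(Z)))` of the outcome. -/
def pred2 (p : Param2 ΘA2 ΘW qA d) (q : Param1 ΘA1 ΘZ pA pZ d) (ω : Ω) : ℝ :=
  F.lin2 p (P.A ω) (F.pred1 q (P.A ω) (P.Z ω))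

lemma excess1_nonneg (θ : ΘW) (q : Param1 ΘA1 ΘZ pA pZ d) : 0 ≤ F.excess1 P θ q :=
  integral_nonneg fun _ => sqNorm_nonneg _

lemma kappa1_eq : F.kappa1 P = ⨆ p : F.adm2, ⨅ q : F.adm1, F.excess1 P p.1.θW q := rfl

lemma kappa2_eq : F.kappa2 P = ⨅ p : F.adm2, l2Dist P.μ (P.condAZ P.Y) (F.condBridge P p) := rfl

lemma kappa1_nonneg : 0 ≤ F.kappa1 P :=
  Real.iSup_nonneg fun _ => Real.iInf_nonneg fun _ => F.excess1_nonneg P _ _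

lemma kappa2_nonneg : 0 ≤ F.kappa2 P := Real.iInf_nonneg fun _ => l2Dist_nonneg _ _

end Risk

namespace BoundedBy

variable {F : Model 𝒜 𝒵 𝒲 ΘA1 ΘZ ΘA2 ΘW pA pZ qA d} {P : Population Ω 𝒰 𝒜 𝒵 𝒲} {M : ℝ}
    {p : Param2 ΘA2 ΘW qA d} {q : Param1 ΘA1 ΘZ pA pZ d}

lemma memLp_outcome (h : F.BoundedBy P M) : MemLp P.Y 2 P.μ :=
  MemLp.of_bound P.measY.aestronglyMeasurable M h.outcome

lemma memLp_feature (h : F.BoundedBy P M) (hp : p ∈ F.adm2) (i : Fin d) :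
    MemLp (fun ω => F.ψW p.θW (P.W ω) i) 2 P.μ :=
  MemLp.of_bound ((F.meas_ψW p.θW).eval.comp P.measW).aestronglyMeasurable M <|
    ae_of_all _ fun _ => (abs_apply_le_sqrt_sqNorm _ i).trans (h.feature p hp _)

lemma memLp_pred1 (h : F.BoundedBy P M) (hq : q ∈ F.adm1) (i : Fin d) :
    MemLp (fun ω => F.pred1 q (P.A ω) (P.Z ω) i) 2 P.μ :=
  MemLp.of_bound ((F.measurable_pred1 q).eval.comp
    (P.measA.prodMk P.measZ)).aestronglyMeasurable M <|
    ae_of_all _ fun _ => (abs_apply_le_sqrt_sqNorm _ i).trans (h.stage1 q hq _ _)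

lemma memLp_regress (h : F.BoundedBy P M) (hp : p ∈ F.adm2) (i : Fin d) :
    MemLp (fun ω => F.regress P p.θW ω i) 2 P.μ :=
  (h.memLp_feature hp i).condExp one_le_two

lemma memLp_bridge (h : F.BoundedBy P M) (hp : p ∈ F.adm2) :
    MemLp (fun ω => F.bridge p (P.A ω) (P.W ω)) 2 P.μ :=
  MemLp.of_bound ((F.measurable_bridge p).comp
    (P.measA.prodMk P.measW)).aestronglyMeasurable (M ^ 2) <|
    ae_of_all _ fun _ => h.abs_bridge_le hp _ _

lemma memLp_condBridge (h : F.BoundedBy P M) (hp : p ∈ F.adm2) :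
    MemLp (F.condBridge P p) 2 P.μ :=
  (h.memLp_bridge hp).condExp one_le_two

lemma memLp_pred2 (h : F.BoundedBy P M) (hp : p ∈ F.adm2) (hq : q ∈ F.adm1) :
    MemLp (F.pred2 P p q) 2 P.μ :=
  MemLp.of_bound ((F.measurable_lin2_pred1 p q).comp
    (P.measA.prodMk P.measZ)).aestronglyMeasurable (M ^ 2) <|
    ae_of_all _ fun _ => h.abs_lin2_pred1_le hp hq _ _

lemma integrable_sq_regress_sub_pred1 (h : F.BoundedBy P M) (hp : p ∈ F.adm2) (hq : q ∈ F.adm1)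
    (i : Fin d) :
    Integrable (fun ω => (F.regress P p.θW ω i - F.pred1 q (P.A ω) (P.Z ω) i) ^ 2) P.μ :=
  ((h.memLp_regress hp i).sub (h.memLp_pred1 hq i)).integrable_sq

lemma integrable_sqNorm_regress_sub_pred1 (h : F.BoundedBy P M) (hp : p ∈ F.adm2)
    (hq : q ∈ F.adm1) :
    Integrable (fun ω => sqNorm (F.regress P p.θW ω - F.pred1 q (P.A ω) (P.Z ω))) P.μ :=
  integrable_finsetSum _ fun i _ => h.integrable_sq_regress_sub_pred1 hp hq i

lemma integral_loss1 (h : F.BoundedBy P M) (hp : p ∈ F.adm2) (hq : q ∈ F.adm1) :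
    ∫ x, F.loss1 p.θW q x ∂P.lawWAZ
      = ∑ i, ∫ ω, (F.ψW p.θW (P.W ω) i - F.regress P p.θW ω i) ^ 2 ∂P.μ
        + F.excess1 P p.θW q := by
  have hm : Measurable fun ω => (P.W ω, P.A ω, P.Z ω) := P.measW.prodMk (P.measA.prodMk P.measZ)
  have hint : ∀ i, Integrable (fun ω =>
      (F.ψW p.θW (P.W ω) i - F.pred1 q (P.A ω) (P.Z ω) i) ^ 2) P.μ :=
    fun i => ((h.memLp_feature hp i).sub (h.memLp_pred1 hq i)).integrable_sq
  rw [Population.lawWAZ, integral_map hm.aemeasurable (F.measurable_loss1 _ _).aestronglyMeasurable]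
  simp only [loss1, sqNorm, excess1, Pi.sub_apply]
  rw [integral_finsetSum _ fun i _ => hint i,
    integral_finsetSum _ fun i _ => h.integrable_sq_regress_sub_pred1 hp hq i,
    ← Finset.sum_add_distrib]
  exact Finset.sum_congr rfl fun i _ => Population.integral_sub_sq_eq_add_condAZ
    (h.memLp_feature hp i) (F.measurable_pred1 q).eval (h.memLp_pred1 hq i)

lemma integral_loss2 (h : F.BoundedBy P M) (hp : p ∈ F.adm2) (hq : q ∈ F.adm1) :
    ∫ x, F.loss2 p q x ∂P.lawYAZ
      = ∫ ω, (P.Y ω - P.condAZ P.Y ω) ^ 2 ∂P.μ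
        + l2Dist P.μ (P.condAZ P.Y) (F.pred2 P p q) ^ 2 := by
  have hm : Measurable fun ω => (P.Y ω, P.A ω, P.Z ω) := P.measY.prodMk (P.measA.prodMk P.measZ)
  rw [sq_l2Dist, Population.lawYAZ,
    integral_map hm.aemeasurable (F.measurable_loss2 _ _).aestronglyMeasurable]
  exact Population.integral_sub_sq_eq_add_condAZ h.memLp_outcome (F.measurable_lin2_pred1 p q)
    (h.memLp_pred2 hp hq)

lemma excess1_le (h : F.BoundedBy P M) (hp : p ∈ F.adm2) (hq : q ∈ F.adm1) :
    F.excess1 P p.θW q ≤ 4 * M ^ 2 := by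
  have hrisk : ∫ x, F.loss1 p.θW q x ∂P.lawWAZ ≤ 4 * M ^ 2 :=
    (le_abs_self _).trans (abs_integral_le_of_abs_le
      (ae_of_all _ (h.abs_le_of_mem_class1 ⟨p, hp, q, hq, rfl⟩)))
  rw [h.integral_loss1 hp hq] at hrisk
  have hnoise : 0 ≤ ∑ i, ∫ ω, (F.ψW p.θW (P.W ω) i - F.regress P p.θW ω i) ^ 2 ∂P.μ :=
    Finset.sum_nonneg fun i _ => integral_nonneg fun _ => sq_nonneg _
  linarith

lemma iInf_excess1_le_kappa1 (h : F.BoundedBy P M) (hp : p ∈ F.adm2) (hne : F.adm1.Nonempty) :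
    ⨅ q : F.adm1, F.excess1 P p.θW q ≤ F.kappa1 P := by
  obtain ⟨q₀, hq₀⟩ := hne
  rw [kappa1_eq]
  refine le_ciSup (f := fun p : F.adm2 => ⨅ q : F.adm1, F.excess1 P p.1.θW q)
    ⟨4 * M ^ 2, Set.forall_mem_range.2 fun p' => ?_⟩ ⟨p, hp⟩
  have hbdd : BddBelow (Set.range fun q : F.adm1 => F.excess1 P p'.1.θW q) :=
    ⟨0, Set.forall_mem_range.2 fun _ => F.excess1_nonneg P _ _⟩
  exact (ciInf_le hbdd ⟨q₀, hq₀⟩).trans (h.excess1_le p'.2 hq₀)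

lemma condBridge_ae_eq (h : F.BoundedBy P M) (hp : p ∈ F.adm2) :
    F.condBridge P p =ᵐ[P.μ] fun ω => F.lin2 p (P.A ω) (F.regress P p.θW ω) := by
  simp only [condBridge, bridge, lin2_eq_dotProduct]
  exact Population.condAZ_sum_mul (c := fun j x => F.lin2Coef p x.1 j)
    (f := fun j ω => F.ψW p.θW (P.W ω) j)
    (fun j => ((F.measurable_lin2Coef p).comp measurable_fst).eval)
    (fun j x => h.abs_lin2Coef_le hp x.1 j)
    (fun j => (h.memLp_feature hp j).integrable one_le_two)

lemma l2Dist_condBridge_pred2_le (h : F.BoundedBy P M) (hp : p ∈ F.adm2) (hq : q ∈ F.adm1) :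
    l2Dist P.μ (F.condBridge P p) (F.pred2 P p q) ≤ M * √(F.excess1 P p.θW q) := by
  rw [l2Dist, Real.sqrt_le_left (mul_nonneg h.nonneg (Real.sqrt_nonneg _)), mul_pow,
    Real.sq_sqrt (F.excess1_nonneg P _ _), excess1, ← integral_const_mul]
  refine integral_mono_ae ((h.memLp_condBridge hp).sub (h.memLp_pred2 hp hq)).integrable_sq
    ((h.integrable_sqNorm_regress_sub_pred1 hp hq).const_mul _) ?_
  filter_upwards [h.condBridge_ae_eq hp] with ω hω
  simp only [hω, pred2, ← lin2_sub]
  exact h.lin2_sq_le hp _ _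

section Oracle

variable {m n : ℕ} {lam₁ lam₂ c₁ c₂ Δ₁ Δ₂ : ℝ} {s₁ : Fin m → 𝒲 × 𝒜 × 𝒵}
    {s₂ : Fin n → ℝ × 𝒜 × 𝒵} {qHat : ΘW → Param1 ΘA1 ΘZ pA pZ d} {p' : Param2 ΘA2 ΘW qA d}

theorem excess1_le_of_isStage1Solution (h : F.BoundedBy P M) (hlam : 0 ≤ lam₁)
    (hpen : ∀ q ∈ F.adm1, lam₁ * sqNorm (fun ij : Fin d × (Fin pA × Fin pZ) => q.V ij.1 ij.2) ≤ c₁)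
    (hq : F.IsStage1Solution lam₁ s₁ qHat)
    (hdev : ∀ f ∈ F.class1, |∫ x, f x ∂P.lawWAZ - (m : ℝ)⁻¹ * ∑ i, f (s₁ i)| ≤ Δ₁)
    (hp : p ∈ F.adm2) : F.excess1 P p.θW (qHat p.θW) ≤ F.kappa1 P + c₁ + 2 * Δ₁ := by
  obtain ⟨hadm, hmin⟩ := hq p hp
  have : Nonempty F.adm1 := ⟨⟨_, hadm⟩⟩
  have hle : F.excess1 P p.θW (qHat p.θW) - (c₁ + 2 * Δ₁)
      ≤ ⨅ q : F.adm1, F.excess1 P p.θW q := by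
    refine le_ciInf fun ⟨q', hq'⟩ => ?_
    have hrisk := risk_le_of_penalized_empiricalRisk_le (hmin q' hq')
      (mul_nonneg hlam (sqNorm_nonneg _)) (hpen q' hq') (hdev _ ⟨p, hp, _, hadm, rfl⟩)
      (hdev _ ⟨p, hp, q', hq', rfl⟩)
    rw [h.integral_loss1 hp hadm, h.integral_loss1 hp hq'] at hrisk
    linarith
  linarith [h.iInf_excess1_le_kappa1 hp ⟨_, hadm⟩]

lemma l2Dist_pred2_le_of_isStage2Solution (h : F.BoundedBy P M) (hlam : 0 ≤ lam₂)
    (hpen : ∀ p ∈ F.adm2, lam₂ * sqNorm p.u ≤ c₂) (hq : ∀ p ∈ F.adm2, qHat p.θW ∈ F.adm1)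
    (hp : F.IsStage2Solution lam₂ s₂ qHat p)
    (hdev : ∀ f ∈ F.class2, |∫ x, f x ∂P.lawYAZ - (n : ℝ)⁻¹ * ∑ i, f (s₂ i)| ≤ Δ₂)
    (hp' : p' ∈ F.adm2) :
    l2Dist P.μ (P.condAZ P.Y) (F.pred2 P p (qHat p.θW))
      ≤ l2Dist P.μ (P.condAZ P.Y) (F.pred2 P p' (qHat p'.θW)) + √(c₂ + 2 * Δ₂) := by
  obtain ⟨hadm, hmin⟩ := hp
  have hrisk := risk_le_of_penalized_empiricalRisk_le (hmin p' hp')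
    (mul_nonneg hlam (sqNorm_nonneg _)) (hpen p' hp') (hdev _ ⟨p, hadm, _, hq p hadm, rfl⟩)
    (hdev _ ⟨p', hp', _, hq p' hp', rfl⟩)
  rw [h.integral_loss2 hadm (hq p hadm), h.integral_loss2 hp' (hq p' hp'), add_assoc,
    add_le_add_iff_left] at hrisk
  calc l2Dist P.μ (P.condAZ P.Y) (F.pred2 P p (qHat p.θW))
      ≤ √(l2Dist P.μ (P.condAZ P.Y) (F.pred2 P p' (qHat p'.θW)) ^ 2 + (c₂ + 2 * Δ₂)) :=
        Real.le_sqrt_of_sq_le hrisk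
    _ ≤ √(l2Dist P.μ (P.condAZ P.Y) (F.pred2 P p' (qHat p'.θW)) ^ 2) + √(c₂ + 2 * Δ₂) :=
        sqrt_add_le_sqrt_add_sqrt _ _
    _ = _ := by rw [Real.sqrt_sq (l2Dist_nonneg _ _)]

/-- The two occurrences of the stage 1 error come from passing from `E[h(A, W) | A, Z]` to the
stage 2 prediction for the selected parameter and back for its competitor. -/
theorem l2Dist_condBridge_le_of_isStage2Solution (h : F.BoundedBy P M) (hlam₁ : 0 ≤ lam₁)
    (hlam₂ : 0 ≤ lam₂)
    (hpen₁ : ∀ q ∈ F.adm1,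
      lam₁ * sqNorm (fun ij : Fin d × (Fin pA × Fin pZ) => q.V ij.1 ij.2) ≤ c₁)
    (hpen₂ : ∀ p ∈ F.adm2, lam₂ * sqNorm p.u ≤ c₂)
    (hq : F.IsStage1Solution lam₁ s₁ qHat) (hp : F.IsStage2Solution lam₂ s₂ qHat p)
    (hdev₁ : ∀ f ∈ F.class1, |∫ x, f x ∂P.lawWAZ - (m : ℝ)⁻¹ * ∑ i, f (s₁ i)| ≤ Δ₁)
    (hdev₂ : ∀ f ∈ F.class2, |∫ x, f x ∂P.lawYAZ - (n : ℝ)⁻¹ * ∑ i, f (s₂ i)| ≤ Δ₂) :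
    l2Dist P.μ (P.condAZ P.Y) (F.condBridge P p)
      ≤ 2 * M * √(F.kappa1 P + c₁ + 2 * Δ₁) + F.kappa2 P + √(c₂ + 2 * Δ₂) := by
  have hadm : ∀ p ∈ F.adm2, qHat p.θW ∈ F.adm1 := fun p hp => (hq p hp).1
  have hY : MemLp (P.condAZ P.Y) 2 P.μ := h.memLp_outcome.condExp one_le_two
  have hstage1 : ∀ p ∈ F.adm2, l2Dist P.μ (F.condBridge P p) (F.pred2 P p (qHat p.θW))
      ≤ M * √(F.kappa1 P + c₁ + 2 * Δ₁) := fun p hp =>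
    (h.l2Dist_condBridge_pred2_le hp (hadm p hp)).trans <| mul_le_mul_of_nonneg_left
      (Real.sqrt_le_sqrt (h.excess1_le_of_isStage1Solution hlam₁ hpen₁ hq hdev₁ hp)) h.nonneg
  have : Nonempty F.adm2 := ⟨⟨p, hp.1⟩⟩
  suffices hle : l2Dist P.μ (P.condAZ P.Y) (F.condBridge P p)
      - (2 * M * √(F.kappa1 P + c₁ + 2 * Δ₁) + √(c₂ + 2 * Δ₂)) ≤ F.kappa2 P by linarith
  rw [kappa2_eq]
  refine le_ciInf fun ⟨p', hp'⟩ => ?_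
  have hselected := l2Dist_triangle hY (h.memLp_pred2 hp.1 (hadm p hp.1)) (h.memLp_condBridge hp.1)
  have hcompetitor := l2Dist_triangle hY (h.memLp_condBridge hp') (h.memLp_pred2 hp' (hadm p' hp'))
  rw [l2Dist_comm (F.pred2 P p _)] at hselected
  linarith [hstage1 p hp.1, hstage1 p' hp',
    h.l2Dist_pred2_le_of_isStage2Solution hlam₂ hpen₂ hadm hp hdev₂ hp']

end Oracle

end BoundedBy

end Model

section SampleMean

variable {S : Type*} [MeasurableSpace S] {ν : Measure S} [IsProbabilityMeasure ν] {k : ℕ}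
  {B t : ℝ}

lemma variance_sampleMean_iidLaw {f : S → ℝ} (hf : MemLp f 2 ν) :
    Var[fun s : Fin k → S => (k : ℝ)⁻¹ * ∑ i, f (s i); iidLaw ν k] = Var[f; ν] / k := by
  have hsum := variance_sum_pi (ι := Fin k) (μ := fun _ => ν) fun _ => hf
  rw [Finset.sum_fn, Finset.sum_const, Finset.card_univ, Fintype.card_fin, nsmul_eq_mul] at hsum
  rw [variance_const_mul, hsum]
  rcases eq_or_ne (k : ℝ) 0 with hk | hk
  · simp [hk]
  · field_simp

/-- The error of the mean of `f` on the sample `s`, as an estimate of its expectation. -/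
noncomputable def meanError (ν : Measure S) (f : S → ℝ) (s : Fin k → S) : ℝ :=
  ∫ x, f x ∂ν - (k : ℝ)⁻¹ * ∑ i, f (s i)

lemma lintegral_enorm_sq_meanError_le (hk : 0 < k) {f : S → ℝ} (hf : Measurable f)
    (hB : ∀ x, |f x| ≤ B) :
    ∫⁻ s : Fin k → S, ‖meanError ν f s‖ₑ ^ 2 ∂iidLaw ν k ≤ ENNReal.ofReal (B ^ 2 / k) := by
  have hL : MemLp f 2 ν := .of_bound hf.aestronglyMeasurable B (ae_of_all _ hB)
  have hmean : MemLp (fun s : Fin k → S => (k : ℝ)⁻¹ * ∑ i, f (s i)) 2 (iidLaw ν k) :=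
    (memLp_finsetSum _ fun i _ =>
      hL.comp_measurePreserving (measurePreserving_eval (fun _ => ν) i)).const_mul _
  have hosc : ∀ x y, |f x - f y| ≤ 2 * B := fun x y => by
    linarith [abs_sub (f x) (f y), hB x, hB y]
  have hvar : Var[f; ν] ≤ B ^ 2 := by
    simpa using variance_le_of_abs_sub_le hf.aemeasurable hosc
  calc ∫⁻ s : Fin k → S, ‖meanError ν f s‖ₑ ^ 2 ∂iidLaw ν k
      = eVar[fun s : Fin k → S => (k : ℝ)⁻¹ * ∑ i, f (s i); iidLaw ν k] := by
        simp only [evariance, integral_sampleMean_iidLaw hk (hL.integrable one_le_two),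
          meanError, ← enorm_neg (∫ x, f x ∂ν - _), neg_sub]
    _ = ENNReal.ofReal (Var[f; ν] / k) := by
        rw [← hmean.ofReal_variance_eq, variance_sampleMean_iidLaw hL]
    _ ≤ ENNReal.ofReal (B ^ 2 / k) := by gcongr

lemma eLpNorm_two_sq {X : Type*} [MeasurableSpace X] {μ : Measure X} (f : X → ℝ) :
    eLpNorm f 2 μ ^ 2 = ∫⁻ x, ‖f x‖ₑ ^ 2 ∂μ := by
  simpa using eLpNorm_nnreal_pow_eq_lintegral (μ := μ) (f := f) (p := 2) two_ne_zero

variable {X α : Type*} [MeasurableSpace X] [MeasurableSpace α] {Q : Measure X} {μ : Measure α}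

lemma measurable_meanError {b : X → S → ℝ} (hb : Measurable fun y : X × S => b y.1 y.2) :
    Measurable fun y : X × (Fin k → S) => meanError ν (b y.1) y.2 := by
  have hmean : Measurable fun x => ∫ w, b x w ∂ν :=
    hb.stronglyMeasurable.integral_prod_right'.measurable
  refine (hmean.comp measurable_fst).sub (.const_mul (Finset.measurable_sum _ fun i _ => ?_) _)
  exact hb.comp (f := fun y : X × (Fin k → S) => (y.1, y.2 i)) (by fun_prop)

lemma lintegral_sq_eLpNorm_meanError_le [IsProbabilityMeasure μ] (hk : 0 < k) {b : α → S → ℝ}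
    (hb : Measurable fun y : α × S => b y.1 y.2) (hB : ∀ a w, |b a w| ≤ B) :
    ∫⁻ s : Fin k → S, eLpNorm (fun a => meanError ν (b a) s) 2 μ ^ 2 ∂iidLaw ν k
      ≤ ENNReal.ofReal (B ^ 2 / k) := by
  simp only [eLpNorm_two_sq]
  rw [lintegral_lintegral_swap
    ((measurable_meanError hb).comp measurable_swap |>.enorm.pow_const 2).aemeasurable]
  refine (lintegral_mono fun a => lintegral_enorm_sq_meanError_le hk
    (hb.comp measurable_prodMk_left) (hB a)).trans_eq ?_
  rw [lintegral_const, measure_univ, mul_one]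

lemma measurable_sq_eLpNorm_meanError [SFinite μ] {b : X → α → S → ℝ}
    (hb : Measurable fun y : X × (α × S) => b y.1 y.2.1 y.2.2) :
    Measurable fun y : X × (Fin k → S) => eLpNorm (fun a => meanError ν (b y.1 a) y.2) 2 μ ^ 2 := by
  have herr : Measurable fun y : (X × α) × (Fin k → S) => meanError ν (b y.1.1 y.1.2) y.2 :=
    measurable_meanError (b := fun x : X × α => b x.1 x.2)
      (hb.comp (f := fun y : (X × α) × S => (y.1.1, (y.1.2, y.2))) (by fun_prop))
  simp only [eLpNorm_two_sq]
  exact ((herr.comp (f := fun y : (X × (Fin k → S)) × α => ((y.1.1, y.2), y.1.2))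
    (by fun_prop)).enorm.pow_const 2).lintegral_prod_right'

theorem measure_lt_eLpNorm_meanError_le [IsProbabilityMeasure Q] [IsProbabilityMeasure μ]
    (hk : 0 < k) {b : X → α → S → ℝ} (hb : Measurable fun y : X × (α × S) => b y.1 y.2.1 y.2.2)
    (hB : ∀ᵐ x ∂Q, ∀ a w, |b x a w| ≤ B) (ht : 0 < t) :
    (Q.prod (iidLaw ν k))
        {y | ENNReal.ofReal (t / √k) < eLpNorm (fun a => meanError ν (b y.1 a) y.2) 2 μ}
      ≤ ENNReal.ofReal (B ^ 2 / t ^ 2) := by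
  have hk' : (0 : ℝ) < k := Nat.cast_pos.mpr hk
  have ht' : 0 < t ^ 2 / k := by positivity
  let N : X × (Fin k → S) → ℝ≥0∞ := fun y => eLpNorm (fun a => meanError ν (b y.1 a) y.2) 2 μ ^ 2
  have hN : Measurable N := measurable_sq_eLpNorm_meanError hb
  have hmean : ∫⁻ y, N y ∂(Q.prod (iidLaw ν k)) ≤ ENNReal.ofReal (B ^ 2 / k) := by
    rw [lintegral_prod _ hN.aemeasurable]
    refine (lintegral_mono_ae (g := fun _ => ENNReal.ofReal (B ^ 2 / k)) ?_).trans_eq (by simp)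
    filter_upwards [hB] with x hx
    have hbx : Measurable fun y : α × S => b x y.1 y.2 :=
      hb.comp (f := fun y : α × S => (x, y)) measurable_prodMk_left
    exact lintegral_sq_eLpNorm_meanError_le (b := b x) hk hbx hx
  calc _ ≤ (Q.prod (iidLaw ν k)) {y | ENNReal.ofReal (t ^ 2 / k) ≤ N y} := by
        refine measure_mono fun y hy => ?_
        have hsq : ENNReal.ofReal (t / √k) ^ 2 ≤ N y := pow_le_pow_left' (le_of_lt hy) 2
        rwa [← ENNReal.ofReal_pow (by positivity), div_pow, Real.sq_sqrt hk'.le] at hsq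
    _ ≤ (∫⁻ y, N y ∂(Q.prod (iidLaw ν k))) / ENNReal.ofReal (t ^ 2 / k) :=
        meas_ge_le_lintegral_div hN.aemeasurable (by simpa using ht') ENNReal.ofReal_ne_top
    _ ≤ ENNReal.ofReal (B ^ 2 / k) / ENNReal.ofReal (t ^ 2 / k) := by gcongr
    _ = ENNReal.ofReal (B ^ 2 / t ^ 2) := by
        rw [← ENNReal.ofReal_div_of_pos ht', div_div_div_cancel_right₀ hk'.ne']

lemma ofReal_rpow_one_half (x : ℝ) : ENNReal.ofReal x ^ (1 / 2 : ℝ) = ENNReal.ofReal √x := by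
  rcases le_total 0 x with hx | hx
  · rw [ENNReal.ofReal_rpow_of_nonneg hx one_half_pos.le, Real.sqrt_eq_rpow]
  · simp [Real.sqrt_eq_zero_of_nonpos hx, ENNReal.ofReal_of_nonpos hx]

lemma eLpNorm_two_integral_prod_le {f : α × S → ℝ} (hf : Measurable f) :
    eLpNorm (fun a => ∫ w, f (a, w) ∂ν) 2 μ ≤ eLpNorm f 2 (μ.prod ν) := by
  rw [← ENNReal.pow_le_pow_left_iff two_ne_zero, eLpNorm_two_sq, eLpNorm_two_sq,
    lintegral_prod _ (hf.enorm.pow_const 2).aemeasurable]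
  refine lintegral_mono fun a => ?_
  have hfa : AEStronglyMeasurable (fun w => f (a, w)) ν :=
    (hf.comp measurable_prodMk_left).aestronglyMeasurable
  rw [← eLpNorm_two_sq]
  gcongr
  calc ‖∫ w, f (a, w) ∂ν‖ₑ ≤ eLpNorm (fun w => f (a, w)) 1 ν := by
        rw [eLpNorm_one_eq_lintegral_enorm]
        exact enorm_integral_le_lintegral_enorm _
    _ ≤ eLpNorm (fun w => f (a, w)) 2 ν := eLpNorm_le_eLpNorm_of_exponent_le one_le_two hfa

end SampleMean

lemma Population.GoodSupport.eLpNorm_integral_le {Ω 𝒰 𝒜 𝒵 𝒲 : Type*} [MeasurableSpace Ω]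
    [MeasurableSpace 𝒰] [MeasurableSpace 𝒜] [MeasurableSpace 𝒵] [MeasurableSpace 𝒲]
    {P : Population Ω 𝒰 𝒜 𝒵 𝒲} {η : ℝ} (hη : P.GoodSupport η) {f : 𝒜 × 𝒲 → ℝ}
    (hf : Measurable f) :
    eLpNorm (fun a => ∫ w, f (a, w) ∂P.lawW) 2 P.lawA
      ≤ ENNReal.ofReal √η * eLpNorm (fun ω => f (P.A ω, P.W ω)) 2 P.μ :=
  calc _ ≤ eLpNorm f 2 (P.lawA.prod P.lawW) := eLpNorm_two_integral_prod_le hf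
    _ ≤ eLpNorm f 2 (ENNReal.ofReal η • P.lawAW) := eLpNorm_mono_measure f hη
    _ = ENNReal.ofReal √η * eLpNorm f 2 P.lawAW := by
        rw [eLpNorm_smul_measure_of_ne_top ENNReal.ofNat_ne_top, smul_eq_mul,
          ← ofReal_rpow_one_half]
        simp
    _ = ENNReal.ofReal √η * eLpNorm (fun ω => f (P.A ω, P.W ω)) 2 P.μ := by
        congr 1
        exact eLpNorm_map_measure hf.aestronglyMeasurable (P.measA.prodMk P.measW).aemeasurable

namespace Model

variable {Ω 𝒰 𝒜 𝒵 𝒲 ΘA1 ΘZ ΘA2 ΘW : Type*} [MeasurableSpace Ω] [MeasurableSpace 𝒰]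
    [MeasurableSpace 𝒜] [MeasurableSpace 𝒵] [MeasurableSpace 𝒲] {pA pZ qA d : ℕ}
    {F : Model 𝒜 𝒵 𝒲 ΘA1 ΘZ ΘA2 ΘW pA pZ qA d} {P : Population Ω 𝒰 𝒜 𝒵 𝒲} {M η : ℝ}
    {hstar : 𝒜 → 𝒲 → ℝ} {p : Param2 ΘA2 ΘW qA d}

lemma eLpNorm_bridge_sub_le_illPosedness_mul (hτ : F.illPosedness P hstar ≠ ∞)
    (hp : p ∈ F.adm2)
    (hfin : eLpNorm (P.condAZ fun ω =>
      F.bridge p (P.A ω) (P.W ω) - hstar (P.A ω) (P.W ω)) 2 P.μ ≠ ∞) :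
    eLpNorm (fun ω => F.bridge p (P.A ω) (P.W ω) - hstar (P.A ω) (P.W ω)) 2 P.μ
      ≤ F.illPosedness P hstar * eLpNorm (P.condAZ fun ω =>
          F.bridge p (P.A ω) (P.W ω) - hstar (P.A ω) (P.W ω)) 2 P.μ :=
  (ENNReal.div_le_iff_le_mul (.inr hτ) (.inl hfin)).mp (le_iSup₂_of_le p hp le_rfl)

namespace BoundedBy

lemma eLpNorm_condAZ_bridge_sub (h : F.BoundedBy P M) (hb : P.IsBridge hstar) (hp : p ∈ F.adm2) :
    eLpNorm (P.condAZ fun ω => F.bridge p (P.A ω) (P.W ω) - hstar (P.A ω) (P.W ω)) 2 P.μ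
      = ENNReal.ofReal (l2Dist P.μ (P.condAZ P.Y) (F.condBridge P p)) := by
  have hY : MemLp (P.condAZ P.Y) 2 P.μ := h.memLp_outcome.condExp one_le_two
  have hsub : P.condAZ (fun ω => F.bridge p (P.A ω) (P.W ω) - hstar (P.A ω) (P.W ω))
      =ᵐ[P.μ] F.condBridge P p - P.condAZ P.Y :=
    (condExp_sub ((h.memLp_bridge hp).integrable one_le_two)
      (hb.memLp.integrable one_le_two) _).trans (Filter.EventuallyEq.rfl.sub hb.bridge.symm)
  rw [eLpNorm_congr_ae hsub, eLpNorm_sub_eq_ofReal_l2Dist (h.memLp_condBridge hp) hY, l2Dist_comm]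

lemma eLpNorm_fStruct_sub_fHat_le [StandardBorelSpace Ω] [StandardBorelSpace 𝒵]
    [StandardBorelSpace 𝒜] [StandardBorelSpace 𝒲] (h : F.BoundedBy P M) (hS : P.Structural)
    (hU : P.CompleteFor P.U) (hb : P.IsBridge hstar) (hη : P.GoodSupport η) (hp : p ∈ F.adm2)
    {k : ℕ} (w : Fin k → 𝒲) :
    eLpNorm (fun a => P.fStruct a - F.fHat p w a) 2 P.lawA
      ≤ ENNReal.ofReal √η *
          eLpNorm (fun ω => F.bridge p (P.A ω) (P.W ω) - hstar (P.A ω) (P.W ω)) 2 P.μ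
        + eLpNorm (fun a => meanError P.lawW (F.bridge p a) w) 2 P.lawA := by
  have hbr := F.measurable_bridge p
  have hdiff : Measurable fun x : 𝒜 × 𝒲 => F.bridge p x.1 x.2 - hstar x.1 x.2 :=
    hbr.sub hb.measurable
  let f : 𝒜 → ℝ := fun a => ∫ w, (F.bridge p a w - hstar a w) ∂P.lawW
  let g : 𝒜 → ℝ := fun a => meanError P.lawW (F.bridge p a) w
  have hf : AEStronglyMeasurable f P.lawA :=
    hdiff.stronglyMeasurable.integral_prod_right'.aestronglyMeasurable
  have hg : AEStronglyMeasurable g P.lawA :=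
    ((measurable_meanError hbr).comp measurable_prodMk_right).aestronglyMeasurable
  have hsplit : (fun a => P.fStruct a - F.fHat p w a) =ᵐ[P.lawA] g - f := by
    filter_upwards [hb.fStruct_ae_eq hS hU h.outcome hη,
      ae_memLp_two_section (hη.memLp_two hb.measurable hb.memLp)] with a ha hstar_a
    have hint : Integrable (F.bridge p a) P.lawW :=
      .of_bound (hbr.comp measurable_prodMk_left).aestronglyMeasurable (M ^ 2)
        (ae_of_all _ (h.abs_bridge_le hp a))
    simp only [ha, Pi.sub_apply, f, g, meanError, F.fHat_eq]
    rw [integral_sub hint (hstar_a.integrable one_le_two)]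
    ring
  rw [eLpNorm_congr_ae hsplit, add_comm]
  exact (eLpNorm_sub_le hg hf one_le_two).trans
    (add_le_add_right (hη.eLpNorm_integral_le hdiff) _)

end BoundedBy

end Model

/-- The deviation `t` for which the three exceptional events (non-representative stage 1 or stage 2
samples, large error of the mean over the extra sample), whose probabilities Chebyshev's inequality
bounds by multiples of `1 / t ^ 2`, have total probability at most `δ`. -/
noncomputable def deviationScale (M δ : ℝ) : ℝ :=
  √((4 * (4 * M ^ 2) ^ 2 + 4 * ((M + M ^ 2) ^ 2) ^ 2 + (M ^ 2) ^ 2 + 1) / δ)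

lemma deviationScale_pos (M : ℝ) {δ : ℝ} (hδ : 0 < δ) : 0 < deviationScale M δ :=
  Real.sqrt_pos.mpr (by positivity)

lemma exceptionalProbability_deviationScale_le (M : ℝ) {δ : ℝ} (hδ : 0 < δ) :
    4 * ((4 * M ^ 2) ^ 2 / deviationScale M δ ^ 2)
        + 4 * (((M + M ^ 2) ^ 2) ^ 2 / deviationScale M δ ^ 2)
        + (M ^ 2) ^ 2 / deviationScale M δ ^ 2 ≤ δ := by
  have ht : 0 < deviationScale M δ ^ 2 := pow_pos (deviationScale_pos M hδ) 2
  have hsq : deviationScale M δ ^ 2 * δ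
      = 4 * (4 * M ^ 2) ^ 2 + 4 * ((M + M ^ 2) ^ 2) ^ 2 + (M ^ 2) ^ 2 + 1 := by
    rw [deviationScale, Real.sq_sqrt (by positivity), div_mul_cancel₀ _ hδ.ne']
  rw [← mul_div_assoc, ← mul_div_assoc, ← add_div, ← add_div, div_le_iff₀ ht, mul_comm δ, hsq]
  exact (lt_add_one _).le

/-- The factor between the error of the estimated bridge equation and `Model.bridgeRate` when the
samples are representative up to the deviation `t`. -/
noncomputable def riskConst (M Λ t : ℝ) : ℝ :=
  (2 * |M| + 1) * √(4 + |Λ| + 6 * t) + 1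

lemma riskConst_nonneg (M Λ t : ℝ) : 0 ≤ riskConst M Λ t := by
  unfold riskConst
  positivity

lemma sqrt_risk_le {Λ t κ R a : ℝ} (ht : 0 ≤ t) (hκ : 0 ≤ κ) (hR : 0 ≤ R) (ha : 0 ≤ a) :
    √(κ + Λ * a + 2 * (2 * R + 3 * (t * a))) ≤ √(4 + |Λ| + 6 * t) * √(κ + R + a) := by
  rw [← Real.sqrt_mul (by positivity)]
  refine Real.sqrt_le_sqrt ?_
  have hΛ : Λ * a ≤ |Λ| * a := mul_le_mul_of_nonneg_right (le_abs_self Λ) ha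
  have hcross : 0 ≤ (|Λ| + 6 * t) * (κ + R) := by positivity
  linarith

lemma add_sqrt_risk_le_riskConst_mul {M Λ t κ₁ κ₂ R₁ R₂ a b : ℝ} (ht : 0 ≤ t) (hκ₁ : 0 ≤ κ₁)
    (hκ₂ : 0 ≤ κ₂) (hR₁ : 0 ≤ R₁) (hR₂ : 0 ≤ R₂) (ha : 0 ≤ a) (hb : 0 ≤ b) :
    2 * M * √(κ₁ + Λ * a + 2 * (2 * R₁ + 3 * (t * a))) + κ₂
        + √(Λ * b + 2 * (2 * R₂ + 3 * (t * b)))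
      ≤ riskConst M Λ t * (√(κ₁ + R₁ + a) + κ₂ + √(R₂ + b)) := by
  have hstage1 := sqrt_risk_le (Λ := Λ) ht hκ₁ hR₁ ha
  have hstage2 := sqrt_risk_le (Λ := Λ) ht le_rfl hR₂ hb
  simp only [zero_add] at hstage2
  rw [riskConst]
  set K := √(4 + |Λ| + 6 * t)
  set x := √(κ₁ + R₁ + a)
  set y := √(R₂ + b)
  calc _ ≤ 2 * |M| * (K * x) + κ₂ + K * y := by gcongr; exact le_abs_self M
    _ ≤ 2 * |M| * (K * x) + κ₂ + K * y
          + (K * x + x + (2 * |M| + 1) * K * κ₂ + 2 * |M| * K * y + y) :=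
        le_add_of_nonneg_right (by positivity)
    _ = ((2 * |M| + 1) * K + 1) * (x + κ₂ + y) := by ring

namespace Model

variable {Ω 𝒰 𝒜 𝒵 𝒲 ΘA1 ΘZ ΘA2 ΘW : Type*} [MeasurableSpace Ω] [MeasurableSpace 𝒰]
    [MeasurableSpace 𝒜] [MeasurableSpace 𝒵] [MeasurableSpace 𝒲] {pA pZ qA d m n k : ℕ}

/-- The rate at which the bridge equation is solved: approximation error plus empirical Rademacher
complexity plus sampling error, for both stages. -/
noncomputable def bridgeRate (F : Model 𝒜 𝒵 𝒲 ΘA1 ΘZ ΘA2 ΘW pA pZ qA d)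
    (P : Population Ω 𝒰 𝒜 𝒵 𝒲) (s₁ : Fin m → 𝒲 × 𝒜 × 𝒵) (s₂ : Fin n → ℝ × 𝒜 × 𝒵) : ℝ :=
  √(F.kappa1 P + empRademacher F.class1 s₁ + 1 / √m) + F.kappa2 P
    + √(empRademacher F.class2 s₂ + 1 / √n)

variable {F : Model 𝒜 𝒵 𝒲 ΘA1 ΘZ ΘA2 ΘW pA pZ qA d} {P : Population Ω 𝒰 𝒜 𝒵 𝒲} {M η Λ t : ℝ}
    {hstar : 𝒜 → 𝒲 → ℝ} {lam₁ lam₂ : ℝ} {s₁ : Fin m → 𝒲 × 𝒜 × 𝒵} {s₂ : Fin n → ℝ × 𝒜 × 𝒵}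
    {qHat : ΘW → Param1 ΘA1 ΘZ pA pZ d} {p : Param2 ΘA2 ΘW qA d}

lemma bridgeRate_pos (hm : 0 < m) (hs₁ : 0 ≤ empRademacher F.class1 s₁) :
    0 < F.bridgeRate P s₁ s₂ := by
  have hκ₁ := F.kappa1_nonneg P
  have hκ₂ := F.kappa2_nonneg P
  unfold bridgeRate
  positivity

namespace BoundedBy

lemma l2Dist_condBridge_le_riskConst_mul (h : F.BoundedBy P M) (ht : 0 ≤ t) (hlam₁ : 0 ≤ lam₁)
    (hlam₂ : 0 ≤ lam₂)
    (hpen₁ : ∀ q ∈ F.adm1, lam₁ * sqNorm (fun ij : Fin d × (Fin pA × Fin pZ) => q.V ij.1 ij.2)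
      ≤ Λ / √m)
    (hpen₂ : ∀ p ∈ F.adm2, lam₂ * sqNorm p.u ≤ Λ / √n)
    (hq : F.IsStage1Solution lam₁ s₁ qHat) (hp : F.IsStage2Solution lam₂ s₂ qHat p)
    (hs₁ : IsRepresentative P.lawWAZ F.class1 t s₁)
    (hs₂ : IsRepresentative P.lawYAZ F.class2 t s₂) :
    l2Dist P.μ (P.condAZ P.Y) (F.condBridge P p) ≤ riskConst M Λ t * F.bridgeRate P s₁ s₂ := by
  refine (h.l2Dist_condBridge_le_of_isStage2Solution hlam₁ hlam₂ hpen₁ hpen₂ hq hp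
    hs₁.2 hs₂.2).trans ?_
  simp only [div_eq_mul_one_div Λ, div_eq_mul_one_div t]
  exact add_sqrt_risk_le_riskConst_mul ht (F.kappa1_nonneg P) (F.kappa2_nonneg P) hs₁.1
    hs₂.1 (by positivity) (by positivity)

theorem eLpNorm_fStruct_sub_fHat_le_of_isRepresentative [StandardBorelSpace Ω]
    [StandardBorelSpace 𝒜] [StandardBorelSpace 𝒵] [StandardBorelSpace 𝒲] (h : F.BoundedBy P M)
    (hS : P.Structural) (hU : P.CompleteFor P.U) (hb : P.IsBridge hstar) (hη : P.GoodSupport η)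
    (hm : 0 < m) (ht : 0 < t) (hlam₁ : 0 ≤ lam₁) (hlam₂ : 0 ≤ lam₂)
    (hpen₁ : ∀ q ∈ F.adm1, lam₁ * sqNorm (fun ij : Fin d × (Fin pA × Fin pZ) => q.V ij.1 ij.2)
      ≤ Λ / √m)
    (hpen₂ : ∀ p ∈ F.adm2, lam₂ * sqNorm p.u ≤ Λ / √n)
    (hq : F.IsStage1Solution lam₁ s₁ qHat) (hp : F.IsStage2Solution lam₂ s₂ qHat p)
    (hs₁ : IsRepresentative P.lawWAZ F.class1 t s₁)
    (hs₂ : IsRepresentative P.lawYAZ F.class2 t s₂) {w : Fin k → 𝒲}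
    (hw : eLpNorm (fun a => meanError P.lawW (F.bridge p a) w) 2 P.lawA
      ≤ ENNReal.ofReal (t / √k)) :
    eLpNorm (fun a => P.fStruct a - F.fHat p w a) 2 P.lawA
      ≤ ENNReal.ofReal (√η * riskConst M Λ t + t)
        * (F.illPosedness P hstar * ENNReal.ofReal (F.bridgeRate P s₁ s₂)
          + ENNReal.ofReal (1 / √k)) := by
  have hK := riskConst_nonneg M Λ t
  have hC : 0 < √η * riskConst M Λ t + t := by positivity
  rcases eq_or_ne (F.illPosedness P hstar) ∞ with hτ | hτ
  · have hr : ENNReal.ofReal (F.bridgeRate P s₁ s₂) ≠ 0 :=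
      (ENNReal.ofReal_pos.mpr (bridgeRate_pos hm hs₁.1)).ne'
    rw [hτ, ENNReal.top_mul hr, top_add, ENNReal.mul_top (ENNReal.ofReal_pos.mpr hC).ne']
    exact le_top
  have hinv := eLpNorm_bridge_sub_le_illPosedness_mul hτ hp.1
    (by rw [h.eLpNorm_condAZ_bridge_sub hb hp.1]; exact ENNReal.ofReal_ne_top)
  rw [h.eLpNorm_condAZ_bridge_sub hb hp.1] at hinv
  have hrisk := h.l2Dist_condBridge_le_riskConst_mul ht.le hlam₁ hlam₂ hpen₁ hpen₂ hq hp hs₁ hs₂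
  generalize F.illPosedness P hstar = τ at hinv ⊢
  generalize F.bridgeRate P s₁ s₂ = r at hrisk ⊢
  calc eLpNorm (fun a => P.fStruct a - F.fHat p w a) 2 P.lawA
      ≤ ENNReal.ofReal √η * (τ * ENNReal.ofReal (riskConst M Λ t * r))
          + ENNReal.ofReal (t / √k) :=
        (h.eLpNorm_fStruct_sub_fHat_le hS hU hb hη hp.1 w).trans <|
          add_le_add (mul_le_mul_right (hinv.trans (by gcongr)) _) hw
    _ = ENNReal.ofReal (√η * riskConst M Λ t) * (τ * ENNReal.ofReal r)
          + ENNReal.ofReal t * ENNReal.ofReal (1 / √k) := by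
        rw [ENNReal.ofReal_mul hK, ENNReal.ofReal_mul (Real.sqrt_nonneg η), div_eq_mul_one_div t,
          ENNReal.ofReal_mul ht.le]
        ring
    _ ≤ ENNReal.ofReal (√η * riskConst M Λ t + t) * (τ * ENNReal.ofReal r)
          + ENNReal.ofReal (√η * riskConst M Λ t + t) * ENNReal.ofReal (1 / √k) := by
        gcongr
        · exact le_add_of_nonneg_right ht.le
        · exact le_add_of_nonneg_left (by positivity)
    _ = _ := (mul_add _ _ _).symm

lemma measure_not_isRepresentative_class1_le (h : F.BoundedBy P M) (hsep : F.PointwiseSeparable)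
    (hm : 0 < m) (ht : 0 < t) :
    iidLaw P.lawWAZ m {s | ¬ IsRepresentative P.lawWAZ F.class1 t s}
      ≤ ENNReal.ofReal (4 * ((4 * M ^ 2) ^ 2 / t ^ 2)) :=
  measure_not_isRepresentative_le hm hsep.isSeparableClass_class1 .univ (by simp) (by positivity)
    (fun _ hf x _ => h.abs_le_of_mem_class1 hf x) ht

lemma measure_not_isRepresentative_class2_le (h : F.BoundedBy P M) (hsep : F.PointwiseSeparable)
    (hn : 0 < n) (ht : 0 < t) :
    iidLaw P.lawYAZ n {s | ¬ IsRepresentative P.lawYAZ F.class2 t s}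
      ≤ ENNReal.ofReal (4 * (((M + M ^ 2) ^ 2) ^ 2 / t ^ 2)) :=
  measure_not_isRepresentative_le hn hsep.isSeparableClass_class2
    (measurableSet_le (measurable_fst.abs) measurable_const) h.ae_abs_fst_le_lawYAZ
    (by positivity) (fun _ hf _ hx => h.abs_le_of_mem_class2 hf hx) ht

theorem measure_exceptional_le {nW : ℕ} {δ : ℝ} (h : F.BoundedBy P M) (hsep : F.PointwiseSeparable)
    (hm : 0 < m) (hn : 0 < n) (hnW : 0 < nW) (hδ : 0 < δ)
    {Q : Measure ((Fin m → 𝒲 × 𝒜 × 𝒵) × (Fin n → ℝ × 𝒜 × 𝒵))}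
    (hQ₁ : Q.map Prod.fst = iidLaw P.lawWAZ m) (hQ₂ : Q.map Prod.snd = iidLaw P.lawYAZ n)
    {pHat : (Fin m → 𝒲 × 𝒜 × 𝒵) × (Fin n → ℝ × 𝒜 × 𝒵) → Param2 ΘA2 ΘW qA d}
    (hadm : ∀ᵐ s ∂Q, pHat s ∈ F.adm2)
    (hmeas : Measurable
      fun x : ((Fin m → 𝒲 × 𝒜 × 𝒵) × (Fin n → ℝ × 𝒜 × 𝒵)) × (𝒜 × 𝒲) =>
        F.bridge (pHat x.1) x.2.1 x.2.2) :
    (Q.prod (iidLaw P.lawW nW)) {x |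
        ¬ IsRepresentative P.lawWAZ F.class1 (deviationScale M δ) x.1.1 ∨
        ¬ IsRepresentative P.lawYAZ F.class2 (deviationScale M δ) x.1.2 ∨
        ENNReal.ofReal (deviationScale M δ / √nW)
          < eLpNorm (fun a => meanError P.lawW (F.bridge (pHat x.1) a) x.2) 2 P.lawA}
      ≤ ENNReal.ofReal δ := by
  have ht := deviationScale_pos M hδ
  have hbound := exceptionalProbability_deviationScale_le M hδ
  set t := deviationScale M δ
  have hfst : MeasurePreserving Prod.fst Q (iidLaw P.lawWAZ m) := ⟨measurable_fst, hQ₁⟩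
  have hsnd : MeasurePreserving Prod.snd Q (iidLaw P.lawYAZ n) := ⟨measurable_snd, hQ₂⟩
  have : IsProbabilityMeasure (Q.map Prod.fst) := hQ₁ ▸ inferInstance
  have : IsProbabilityMeasure Q := Measure.isProbabilityMeasure_of_map Prod.fst
  have hstage1 := ((hfst.comp measurePreserving_fst).measure_preimage_le
    (μa := Q.prod (iidLaw P.lawW nW)) _).trans (h.measure_not_isRepresentative_class1_le hsep hm ht)
  have hstage2 := ((hsnd.comp measurePreserving_fst).measure_preimage_le
    (μa := Q.prod (iidLaw P.lawW nW)) _).trans (h.measure_not_isRepresentative_class2_le hsep hn ht)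
  have hextra := measure_lt_eLpNorm_meanError_le (ν := P.lawW) (μ := P.lawA) hnW
    (b := fun s => F.bridge (pHat s)) hmeas (hadm.mono fun s hs => h.abs_bridge_le hs) ht
  refine (measure_union_le _ _).trans ((add_le_add hstage1
    ((measure_union_le _ _).trans (add_le_add hstage2 hextra))).trans ?_)
  rw [← add_assoc, ← ENNReal.ofReal_add (by positivity) (by positivity),
    ← ENNReal.ofReal_add (by positivity) (by positivity)]
  exact ENNReal.ofReal_le_ofReal hbound

end BoundedBy

end Model

end DFPV

theorem proposition2_general
    {Ω 𝒰 𝒜 𝒵 𝒲 ΘA1 ΘZ ΘA2 ΘW : Type*}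
    [MeasurableSpace Ω] [StandardBorelSpace Ω] [MeasurableSpace 𝒰]
    [MeasurableSpace 𝒜] [StandardBorelSpace 𝒜] [MeasurableSpace 𝒵] [StandardBorelSpace 𝒵]
    [MeasurableSpace 𝒲] [StandardBorelSpace 𝒲]
    (M η Λ δ : ℝ) (hδ : 0 < δ) :
    ∃ C : ℝ, 0 < C ∧
      ∀ (P : DFPV.Population Ω 𝒰 𝒜 𝒵 𝒲) (pA pZ qA d : ℕ)
        (F : DFPV.Model 𝒜 𝒵 𝒲 ΘA1 ΘZ ΘA2 ΘW pA pZ qA d) (hstar : 𝒜 → 𝒲 → ℝ),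
      P.Structural → P.CompleteFor P.U → P.IsBridge hstar →
      F.BoundedBy P M → P.GoodSupport η → F.PointwiseSeparable →
      ∀ (m n nW : ℕ), 0 < m → 0 < n → 0 < nW →
      ∀ (lam1 lam2 : ℝ), 0 ≤ lam1 → 0 ≤ lam2 →
      (∀ q ∈ F.adm1, lam1 * DFPV.sqNorm (fun ij : Fin d × (Fin pA × Fin pZ) => q.V ij.1 ij.2)
        ≤ Λ / √m) →
      (∀ p ∈ F.adm2, lam2 * DFPV.sqNorm p.u ≤ Λ / √n) →
      ∀ (Q : Measure ((Fin m → 𝒲 × 𝒜 × 𝒵) × (Fin n → ℝ × 𝒜 × 𝒵))),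
      Q.map Prod.fst = Measure.pi (fun _ => P.lawWAZ) →
      Q.map Prod.snd = Measure.pi (fun _ => P.lawYAZ) →
      ∀ (qHat : (Fin m → 𝒲 × 𝒜 × 𝒵) → ΘW → DFPV.Param1 ΘA1 ΘZ pA pZ d)
        (pHat : (Fin m → 𝒲 × 𝒜 × 𝒵) × (Fin n → ℝ × 𝒜 × 𝒵) → DFPV.Param2 ΘA2 ΘW qA d),
      (∀ᵐ s ∂Q, F.IsStage1Solution lam1 s.1 (qHat s.1) ∧
        F.IsStage2Solution lam2 s.2 (qHat s.1) (pHat s)) →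
      Measurable (fun x : ((Fin m → 𝒲 × 𝒜 × 𝒵) × (Fin n → ℝ × 𝒜 × 𝒵)) × (𝒜 × 𝒲) =>
        F.bridge (pHat x.1) x.2.1 x.2.2) →
      (Q.prod (Measure.pi (fun _ : Fin nW => P.lawW)))
        {x | ENNReal.ofReal C *
            (F.illPosedness P hstar * ENNReal.ofReal
                (√(F.kappa1 P + DFPV.empRademacher F.class1 x.1.1 + 1 / √m)
                  + F.kappa2 P
                  + √(DFPV.empRademacher F.class2 x.1.2 + 1 / √n))
              + ENNReal.ofReal (1 / √nW))
          < eLpNorm (fun a => P.fStruct a - F.fHat (pHat x.1) x.2 a) 2 P.lawA}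
        ≤ ENNReal.ofReal δ := by
  let t := DFPV.deviationScale M δ
  have ht : 0 < t := DFPV.deviationScale_pos M hδ
  have hK := DFPV.riskConst_nonneg M Λ t
  refine ⟨√η * DFPV.riskConst M Λ t + t, by positivity, ?_⟩
  intro P pA pZ qA d F hstar hS hU hb hF hη hsep m n nW hm hn hnW lam1 lam2 hlam1 hlam2 hpen1 hpen2
    Q hQ1 hQ2 qHat pHat hsol hmeas
  have hadm : ∀ᵐ s ∂Q, pHat s ∈ F.adm2 := hsol.mono fun s hs => hs.2.1
  refine (measure_mono_ae ?_).trans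
    (hF.measure_exceptional_le hsep hm hn hnW hδ hQ1 hQ2 hadm hmeas)
  filter_upwards [Measure.quasiMeasurePreserving_fst.ae hsol] with x ⟨hq, hp⟩ hlarge
  by_contra hgood
  obtain ⟨hs₁, hgood'⟩ := not_or.mp hgood
  obtain ⟨hs₂, hw⟩ := not_or.mp hgood'
  exact hlarge.not_ge (hF.eLpNorm_fStruct_sub_fHat_le_of_isRepresentative hS hU hb hη hm ht
    hlam1 hlam2 hpen1 hpen2 hq hp (not_not.mp hs₁) (not_not.mp hs₂) (not_lt.mp hw))

theorem proposition2
    {Ω 𝒰 𝒜 𝒵 𝒲 ΘA1 ΘZ ΘA2 ΘW : Type*}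
    [MeasurableSpace Ω] [StandardBorelSpace Ω] [MeasurableSpace 𝒰] [StandardBorelSpace 𝒰]
    [MeasurableSpace 𝒜] [StandardBorelSpace 𝒜] [MeasurableSpace 𝒵] [StandardBorelSpace 𝒵]
    [MeasurableSpace 𝒲] [StandardBorelSpace 𝒲]
    (M η Λ δ : ℝ) (hδ : 0 < δ) :
    -- the constant depends on the bounds `M`, `η`, `Λ` and on the confidence level `δ` only
    ∃ C : ℝ, 0 < C ∧
      ∀ (P : DFPV.Population Ω 𝒰 𝒜 𝒵 𝒲) (pA pZ qA d : ℕ)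
        (F : DFPV.Model 𝒜 𝒵 𝒲 ΘA1 ΘZ ΘA2 ΘW pA pZ qA d) (hstar : 𝒜 → 𝒲 → ℝ),
      P.Structural → P.CompleteFor P.U → P.CompleteFor P.W → P.IsBridge hstar →
      F.BoundedBy P M → P.GoodSupport η → F.PointwiseSeparable →
      ∀ (m n nW : ℕ), 0 < m → 0 < n → 0 < nW →
      -- ridge parameters whose penalties are at most of the order of the sampling error
      ∀ (lam1 lam2 : ℝ), 0 ≤ lam1 → 0 ≤ lam2 →
      (∀ q ∈ F.adm1, lam1 * DFPV.sqNorm (fun ij : Fin d × (Fin pA × Fin pZ) => q.V ij.1 ij.2)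
        ≤ Λ / Real.sqrt m) →
      (∀ p ∈ F.adm2, lam2 * DFPV.sqNorm p.u ≤ Λ / Real.sqrt n) →
      -- the joint law of the stage 1 and stage 2 samples: each sample is i.i.d.
      ∀ (Q : Measure ((Fin m → 𝒲 × 𝒜 × 𝒵) × (Fin n → ℝ × 𝒜 × 𝒵))),
      Q.map Prod.fst = Measure.pi (fun _ => P.lawWAZ) →
      Q.map Prod.snd = Measure.pi (fun _ => P.lawYAZ) →
      -- the minimizers of the two empirical losses, as functions of the samples
      ∀ (qHat : (Fin m → 𝒲 × 𝒜 × 𝒵) → ΘW → DFPV.Param1 ΘA1 ΘZ pA pZ d)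
        (pHat : (Fin m → 𝒲 × 𝒜 × 𝒵) × (Fin n → ℝ × 𝒜 × 𝒵) → DFPV.Param2 ΘA2 ΘW qA d),
      (∀ᵐ s ∂Q, F.IsStage1Solution lam1 s.1 (qHat s.1) ∧
        F.IsStage2Solution lam2 s.2 (qHat s.1) (pHat s)) →
      Measurable (fun x : ((Fin m → 𝒲 × 𝒜 × 𝒵) × (Fin n → ℝ × 𝒜 × 𝒵)) × (𝒜 × 𝒲) =>
        F.bridge (pHat x.1) x.2.1 x.2.2) →
      -- the extra sample of `W` is i.i.d. and independent of the other two
      (Q.prod (Measure.pi (fun _ : Fin nW => P.lawW)))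
        {x | ENNReal.ofReal C *
            (F.illPosedness P hstar * ENNReal.ofReal
                (Real.sqrt (F.kappa1 P + DFPV.empRademacher F.class1 x.1.1 + 1 / Real.sqrt m)
                  + F.kappa2 P
                  + Real.sqrt (DFPV.empRademacher F.class2 x.1.2 + 1 / Real.sqrt n))
              + ENNReal.ofReal (1 / Real.sqrt nW))
          < eLpNorm (fun a => P.fStruct a - F.fHat (pHat x.1) x.2 a) 2 P.lawA}
        ≤ ENNReal.ofReal δ := by
  obtain ⟨C, hC, hbound⟩ := proposition2_general (Ω := Ω) (𝒰 := 𝒰) (𝒜 := 𝒜) (𝒵 := 𝒵) (𝒲 := 𝒲)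
    (ΘA1 := ΘA1) (ΘZ := ΘZ) (ΘA2 := ΘA2) (ΘW := ΘW) M η Λ δ hδ
  exact ⟨C, hC, fun P pA pZ qA d F hstar hS hU _ => hbound P pA pZ qA d F hstar hS hU⟩
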